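/- **Setting.** Let $\mathcal M=(\mathcal S,\mathcal A,H,\{p_h\}_{h\in[H]},s_1)$ be a finite episodic reward-free MDP with $S=|\mathcal S|$ states, $A=|\mathcal A|\ge 1$ actions, $H\ge 1$ steps per episode, transition probabilities $p_h(s'|s,a)$ and fixed initial state $s_1$. A general policy is a collection of measurable maps $\psi_h$, where $a_h=\psi_h(I_h,s_h,u_h)$, the history is $I_h=(s_1,a_1,u_1,\dots,s_{h-1},a_{h-1},u_{h-1})$, and the $u_h$ are i.i.d. uniform on $[0,1]$; a Markovian policy draws $a_h\sim\pi_h(\cdot|s_h)$. Let $d^\pi_h(s,a)$ be the probability that $(s_h,a_h)=(s,a)$ under $\pi$, and $\mathrm{VE}(d^\pi)=\sum_{h=1}^H\sum_{s,a}d^\pi_h(s,a)\log\frac1{d^\pi_h(s,a)}$ the visitation entropy. An algorithm that outputs a policy $\hat\pi$ is $(\varepsilon,\delta)$-PAC for maximum visitation entropy exploration if $\mathbb P\big(\max_\pi \mathrm{VE}(d^\pi)-\mathrm{VE}(d^{\hat\pi})\le\varepsilon\big)\ge 1-\delta$, the maximum being over all general policies. **Algorithm (EntGame, prior count $n_0=1$,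 confidence $\delta$, $T$ episodes).** After $t$ episodes let $n_h^t(s,a)$ be the number of visits of $(s,a)$ at step $h$, $n_h^t(s'|s,a)$ the number of transitions from $(s,a)$ to $s'$ at step $h$, $\hat p_h^t(s'|s,a)=n_h^t(s'|s,a)/n_h^t(s,a)$ (uniform if $n_h^t(s,a)=0$). The forecaster predicts $\bar d_h^{t+1}(s,a)=\frac{n_h^t(s,a)+1}{t+SA}$. With the bonuses $$b_h^t(s,a)=\sqrt{\frac{2H^2\log^2(t+SA)\,\alpha(\delta,n_h^t(s,a))}{n_h^t(s,a)}},\qquad \alpha(\delta,n)=\log\frac{2SAH}{\delta}+S\log(e(1+n))$$ ($b_h^t(s,a)=+\infty$ if $n_h^t(s,a)=0$), put $\bar V_{H+1}^t=0$ and, for $h=H,\dots,1$, $$\bar Q_h^t(s,a)=\log\frac1{\bar d_h^{t+1}(s,a)}+\sum_{s'}\hat p_h^t(s'|s,a)\bar V_{h+1}^t(s')+b_h^t(s,a),$$ $$\bar V_h^t(s)=\max\Big(\min\big(\max_a\bar Q_h^t(s,a),\,H\log(t+SA)\big),\,0\Big).$$ In episode $t+1$ the sampler follows a Markovian policy $\pi^{t+1}$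 that is greedy for $\bar Q^t$, i.e. $\pi_h^{t+1}(\cdot|s)$ is supported on the maximizers of $\bar Q_h^t(s,\cdot)$ (ties broken arbitrarily, possibly depending on the past episodes). After $T$ episodes the output $\hat\pi$ is the uniform mixture of $\pi^1,\dots,\pi^T$: draw $t\in[T]$ uniformly, then follow $\pi^t$. **Theorem.** Let $\varepsilon>0$, $\delta\in(0,1)$, $$L=9\log\!\left(\frac{1010\sqrt{H^4S^{8/3}A^{8/3}\log(4SAH/\delta)}}{\varepsilon}\right),$$ $$B=1+\frac{648\,(\log(SA)+L)\,H^4SA\,\big(\log(4SAH/\delta)+S(1+L)\big)\,L}{\varepsilon^2}+\frac{2HSA(2+L)}{\varepsilon}.$$ 1. For every such MDP, every tie-breaking, and every integer $T\ge 1$ with $T\ge B$, EntGame with $n_0=1$ and $T$ episodes is $(\varepsilon,\delta)$-PAC for maximum visitation entropy exploration. 2. This number of episodes is $\widetilde{\mathcal O}\big(\frac{H^4S^2A}{\varepsilon^2}+\frac{HSA}{\varepsilon}\big)$: there is a universal constant $C$ such that for all $S,A,H\ge1$, $\varepsilon\in(0,1]$, $\delta\in(0,1)$, $$\lceil B\rceil\le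 C\,\log^3\!\Big(\frac{4SAH}{\delta\varepsilon}\Big)\Big(\frac{H^4S^2A}{\varepsilon^2}+\frac{HSA}{\varepsilon}\Big).$$ -/

import Mathlib

open scoped BigOperators

noncomputable section

namespace MVEE

/-- A finite episodic reward-free Markov decision process with state set `S`, action set `A`,
`H` steps per episode, step-dependent transition probabilities `p h s a s'` and a fixed
initial state. Steps are numbered `0, …, H - 1`. -/
structure MDP (S A : Type*) [Fintype S] (H : ℕ) where
  p : Fin H → S → A → S → ℝ
  p_mem : ∀ h s a, p h s a ∈ stdSimplex ℝ S
  init : S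

/-- One episode: the visited states `s_0, …, s_H` (the last one is the state observed after the
last action) and the actions `a_0, …, a_{H-1}`. -/
abbrev Episode (S A : Type*) (H : ℕ) : Type _ := (Fin (H + 1) → S) × (Fin H → A)

/-- The state-action pair of an episode at step `h`. -/
def Episode.pair {S A : Type*} {H : ℕ} (m : Episode S A H) (h : Fin H) : S × A :=
  (m.1 h.castSucc, m.2 h)

/-- A (randomized) Markovian policy: a probability distribution over actions for each step and
each state. -/
structure MarkovPolicy (S A : Type*) [Fintype A] (H : ℕ) where
  prob : Fin H → S → A → ℝ
  prob_mem : ∀ h s, prob h s ∈ stdSimplex ℝ A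

/-- A general policy: at step `h` the action is a function of the history
`(s_0, a_0, u_0, …, s_{h-1}, a_{h-1}, u_{h-1})`, of the current state and of a fresh noise `u_h`,
where the `u_i` are i.i.d. uniform on `[0, 1]`. As `S` and `A` are finite, measurability of the
action map is measurability in the noise variables, the other arguments being fixed. -/
structure GeneralPolicy (S A : Type*) (H : ℕ) where
  act : (h : Fin H) → (Fin h → (S × A) × unitInterval) → S → unitInterval → A
  measurable_act : ∀ (h : Fin H) (σ : Fin h → S × A) (s : S) (a : A),
    MeasurableSet {v : (Fin h → unitInterval) × unitInterval |
      act h (fun i => (σ i, v.1 i)) s v.2 = a}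

section Laws

variable {S A : Type*} [Fintype S] [DecidableEq S] {H : ℕ}

/-- The part of the probability of an episode that is due to the environment: the episode starts
in the initial state, and every next state is drawn from the transition kernel. -/
def MDP.transProb (M : MDP S A H) (m : Episode S A H) : ℝ :=
  (if m.1 0 = M.init then 1 else 0) *
    ∏ h : Fin H, M.p h (m.1 h.castSucc) (m.2 h) (m.1 h.succ)

/-- The law of an episode when the Markovian policy `π` is followed. -/
def MarkovPolicy.law [Fintype A] (π : MarkovPolicy S A H) (M : MDP S A H)
    (m : Episode S A H) : ℝ :=
  M.transProb m * ∏ h : Fin H, π.prob h (m.1 h.castSucc) (m.2 h)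

/-- The law of an episode when the general policy `ψ` is followed: given the noise `u`, all actions
are deterministic functions of the past; the noise is then averaged out. -/
def GeneralPolicy.law [DecidableEq A] (ψ : GeneralPolicy S A H) (M : MDP S A H)
    (m : Episode S A H) : ℝ :=
  ∫ u : Fin H → unitInterval,
    M.transProb m *
      ∏ h : Fin H,
        (if ψ.act h (fun i => (m.pair (i.castLE h.isLt.le), u (i.castLE h.isLt.le)))
            (m.1 h.castSucc) (u h) = m.2 h then (1 : ℝ) else 0)

/-- The state-action visitation distributions `d_h(s, a)` of a law `q` on episodes. -/
def visitation [Fintype A] [DecidableEq A] (q : Episode S A H → ℝ) (h : Fin H) (x : S × A) : ℝ :=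
  ∑ m : Episode S A H, if m.pair h = x then q m else 0

/-- The visitation entropy: the sum over the steps of the Shannon entropies of the visitation
distributions. -/
def visitationEntropy [Fintype A] (d : Fin H → S × A → ℝ) : ℝ :=
  ∑ h : Fin H, ∑ x : S × A, Real.negMulLog (d h x)

/-- A sampling rule: the policy of episode `t + 1` is a function of the first `t` episodes. -/
abbrev SamplingRule (S A : Type*) [Fintype A] (H : ℕ) : Type _ :=
  (t : ℕ) → (Fin t → Episode S A H) → MarkovPolicy S A H

/-- The policy used in the `(t + 1)`-st of the `T` episodes `ω`. -/
def SamplingRule.at {S A : Type*} [Fintype A] {H : ℕ} (pol : SamplingRule S A H) {T : ℕ}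
    (ω : Fin T → Episode S A H) (t : Fin T) : MarkovPolicy S A H :=
  pol t (fun i => ω (i.castLE t.isLt.le))

/-- The probability, when the sampling rule `pol` interacts with `M` for `T` episodes, that the
collection of these episodes belongs to `E`. -/
def runProb [Fintype A] (M : MDP S A H) (pol : SamplingRule S A H) (T : ℕ)
    (E : Set (Fin T → Episode S A H)) : ℝ :=
  ∑ ω : Fin T → Episode S A H, E.indicator (fun ω => ∏ t : Fin T, (pol.at ω t).law M (ω t)) ω

/-- The uniform mixture of the policies used during the `T` episodes `ω`, through the law of the
episode that it generates: draw `t` uniformly, then follow the policy of episode `t`. -/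
def mixtureLaw [Fintype A] (M : MDP S A H) (pol : SamplingRule S A H) {T : ℕ}
    (ω : Fin T → Episode S A H) (m : Episode S A H) : ℝ :=
  (1 / (T : ℝ)) * ∑ t : Fin T, (pol.at ω t).law M m

/-- An agent that samples with `pol`, stops after the deterministic number `T` of episodes and
then outputs a policy whose episode law is `out ω` is `(ε, δ)`-PAC for maximum visitation entropy
exploration: with probability at least `1 - δ` the visitation entropy of its output is within `ε`
of that of every general policy. -/
def IsPAC [Fintype A] [DecidableEq A] (M : MDP S A H) (pol : SamplingRule S A H) (T : ℕ)
    (out : (Fin T → Episode S A H) → Episode S A H → ℝ) (ε δ : ℝ) : Prop :=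
  1 - δ ≤ runProb M pol T {ω | ∀ ψ : GeneralPolicy S A H,
    visitationEntropy (visitation (ψ.law M)) - visitationEntropy (visitation (out ω)) ≤ ε}

end Laws

section Algorithm

variable {S A : Type*} [Fintype S] [DecidableEq S] [Fintype A] [DecidableEq A] {H : ℕ}

/-- `n_h^t(s, a)`: number of visits of `(s, a)` at step `h` in the `t` episodes `ω`. -/
def count {t : ℕ} (ω : Fin t → Episode S A H) (h : Fin H) (s : S) (a : A) : ℕ :=
  (Finset.univ.filter fun i : Fin t => (ω i).pair h = (s, a)).card

/-- `n_h^t(s' | s, a)`: number of transitions from `(s, a)` to `s'` at step `h`. -/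
def transCount {t : ℕ} (ω : Fin t → Episode S A H) (h : Fin H) (s : S) (a : A) (s' : S) : ℕ :=
  (Finset.univ.filter fun i : Fin t => (ω i).pair h = (s, a) ∧ (ω i).1 h.succ = s').card

/-- The empirical transition probabilities (uniform if `(s, a)` was not visited at step `h`). -/
def empTrans {t : ℕ} (ω : Fin t → Episode S A H) (h : Fin H) (s : S) (a : A) (s' : S) : ℝ :=
  if 0 < count ω h s a then (transCount ω h s a s' : ℝ) / count ω h s a
  else 1 / (Fintype.card S : ℝ)

/-- The forecaster's prediction for episode `t + 1`: the posterior mean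
`(n_h^t(s, a) + n₀) / (t + S A n₀)` under a Dirichlet prior with all parameters `n₀`. -/
def forecast (n₀ : ℝ) {t : ℕ} (ω : Fin t → Episode S A H) (h : Fin H) (s : S) (a : A) : ℝ :=
  (count ω h s a + n₀) / (t + Fintype.card S * Fintype.card A * n₀)

/-- The confidence threshold `log (2 S A H / δ) + S log (e (1 + n))`, for cardinalities
`S`, `A`. -/
def alphaKL (S A H : ℕ) (δ : ℝ) (n : ℕ) : ℝ :=
  Real.log (2 * S * A * H / δ) + S * Real.log (Real.exp 1 * (1 + n))

/-- The Hoeffding-type exploration bonus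
`√(2 H² log² (t + S A) α(δ, n) / n)`, `n = n_h^t(s, a)`; it is infinite if `n = 0`. -/
def bonus (δ : ℝ) {t : ℕ} (ω : Fin t → Episode S A H) (h : Fin H) (s : S) (a : A) : EReal :=
  if count ω h s a = 0 then ⊤
  else ((Real.sqrt (2 * (H : ℝ) ^ 2 * Real.log (t + Fintype.card S * Fintype.card A) ^ 2 *
    alphaKL (Fintype.card S) (Fintype.card A) H δ (count ω h s a) / count ω h s a) : ℝ) : EReal)

/-- One step of optimistic planning: the optimistic value of `(s, a)` at step `h` when `V` is the
optimistic value function of the next step. -/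
def planStep (n₀ δ : ℝ) {t : ℕ} (ω : Fin t → Episode S A H) (h : Fin H) (V : S → ℝ)
    (s : S) (a : A) : EReal :=
  ((Real.log (1 / forecast n₀ ω h s a) + ∑ s' : S, empTrans ω h s a s' * V s' : ℝ) : EReal)
    + bonus δ ω h s a

/-- `clip(x, lo, hi) = max (min (x, hi), lo)`; the value is a real number as `lo`, `hi` are. -/
def clip (x : EReal) (lo hi : ℝ) : ℝ := (max (min x (hi : EReal)) (lo : EReal)).toReal

/-- The optimistic value function at step `h`, after the `t` episodes `ω`:
`V_H = 0` and `V_h(s) = clip (max_a Q_h(s, a), 0, log (t / n₀ + S A) H)` for `h < H`. -/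
def optV (n₀ δ : ℝ) {t : ℕ} (ω : Fin t → Episode S A H) (h : ℕ) : S → ℝ :=
  if hh : h < H then fun s =>
    clip (⨆ a : A, planStep n₀ δ ω ⟨h, hh⟩ (optV n₀ δ ω (h + 1)) s a) 0
      (Real.log (t / n₀ + Fintype.card S * Fintype.card A) * H)
  else fun _ => 0
termination_by H - h

/-- The optimistic action-value function at step `h`, after the `t` episodes `ω`. -/
def optQ (n₀ δ : ℝ) {t : ℕ} (ω : Fin t → Episode S A H) (h : Fin H) (s : S) (a : A) : EReal :=
  planStep n₀ δ ω h (optV n₀ δ ω (h + 1)) s a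

/-- The sampling rule is that of the EntGame algorithm with prior count `n₀` and confidence
parameter `δ`: the policy of episode `t + 1` is greedy, i.e. supported on maximizers, with respect
to the optimistic action values computed from the first `t` episodes. Ties may be broken in any
way. -/
def IsEntGame (n₀ δ : ℝ) (pol : SamplingRule S A H) : Prop :=
  ∀ (t : ℕ) (ω : Fin t → Episode S A H) (h : Fin H) (s : S) (a : A),
    (pol t ω).prob h s a ≠ 0 → ∀ a' : A, optQ n₀ δ ω h s a' ≤ optQ n₀ δ ω h s a

end Algorithm

/-- The logarithmic factor `L = 9 log (1010 √(H⁴ S^{8/3} A^{8/3} log (4 S A H / δ)) / ε)`. -/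
def logFactor (S A H : ℕ) (ε δ : ℝ) : ℝ :=
  9 * Real.log (1010 * Real.sqrt ((H : ℝ) ^ 4 * (S : ℝ) ^ (8 / 3 : ℝ) * (A : ℝ) ^ (8 / 3 : ℝ) *
    Real.log (4 * S * A * H / δ)) / ε)

/-- The number of episodes that suffices. -/
def episodeBound (S A H : ℕ) (ε δ : ℝ) : ℝ :=
  1 + 648 * (Real.log (S * A) + logFactor S A H ε δ) * (H : ℝ) ^ 4 * S * A *
        (Real.log (4 * S * A * H / δ) + S * (1 + logFactor S A H ε δ)) *
        logFactor S A H ε δ / ε ^ 2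
    + 2 * H * S * A * (2 + logFactor S A H ε δ) / ε

end MVEE

end

/-! Entropy maximisation is treated as a game between a forecaster and a sampler. By Gibbs'
inequality the entropy of a visitation distribution is at most its cross-entropy against any
prediction, so the visitation entropy of every policy is at most its return for the reward `log (1 /
forecast)` (`visitationEntropy_le_sum_reward`). When the transition estimates are accurate, the
optimistic value dominates the return of every policy (`AccurateTrans.sum_reward_le_optV`).
Greediness bounds this value by the return of the policy actually played, plus planning errors of
about twice the bonus (`AccurateTrans.optV_le_sum_reward`).

Summing over episodes and passing from expected to sampled returns leaves two path sums. The
planning errors are summed by a potential argument in the visit counts (`sum_path_planError_le`). At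
each step `h` the rewards sum to minus the logarithm of the probability that the Laplace rule
assigns to the observed pairs. This exceeds `T` times the empirical entropy by only `S A log (T +
1)`, and the empirical entropy exceeds that of the mixture only by a deviation of counts from
visitation probabilities (`sum_path_reward_le`). `entropy_gap_le` collects these bounds.

Only three kinds of random events matter, all controlled through Ville's inequality. For
transitions, the ratio of Laplace likelihood to true likelihood is a supermartingale; if it stays
small, `n` times the KL divergence of the empirical from the true kernel is below `alphaKL`.
Comparison with the Hellinger distance then controls the expectations of all bounded `V` at once,
with no covering argument (`abs_empTrans_sub_mul_le`). Counts and returns use a Bernstein-type bound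
(`sum_sub_expect_deviation`).

The total regret is of order `H² log(T + SA) √(SA·T·Λ)` plus lower-order terms, with `Λ` of order
`log(SAH/δ) + S log(T + SA)`. It is at most `ε T` once `T ≥ B` (`total_regret_le`,
`regret_le_of_episodeBound_le`). If `ε ≥ H log(SA)` there is nothing to prove, since entropies lie
in `[0, H log(SA)]`. -/

open scoped BigOperators

noncomputable section

namespace MVEE

/-! ### Adapted sequences: Ville's inequality and a Bernstein-type deviation bound. -/

section Sequences

variable {X : Type*}

/-- The probability of a finite sequence when each term is drawn from a kernel given the
previous terms. -/
def seqProb (k : (t : ℕ) → (Fin t → X) → X → ℝ) (T : ℕ) (ω : Fin T → X) : ℝ :=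
  ∏ t : Fin T, k t (fun i => ω (i.castLE t.isLt.le)) (ω t)

theorem snoc_castLE {T : ℕ} (ω : Fin T → X) (x : X) {t : ℕ} (ht : t ≤ T) (ht' : t ≤ T + 1) :
    (fun i : Fin t => (Fin.snoc (α := fun _ => X) ω x : Fin (T + 1) → X) (i.castLE ht')) =
      fun i => ω (i.castLE ht) := by
  funext i
  have : i.castLE ht' = (i.castLE ht).castSucc := rfl
  rw [this, Fin.snoc_castSucc]

theorem seqProb_snoc (k : (t : ℕ) → (Fin t → X) → X → ℝ) (T : ℕ) (ω : Fin T → X) (x : X) :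
    seqProb k (T + 1) (Fin.snoc (α := fun _ => X) ω x) = seqProb k T ω * k T ω x := by
  unfold seqProb
  rw [Fin.prod_univ_castSucc]
  congr 1
  · refine Finset.prod_congr rfl fun t _ => ?_
    rw [Fin.snoc_castSucc]
    congr 1
    exact snoc_castLE ω x t.isLt.le _
  · rw [Fin.snoc_last]
    congr 1
    exact snoc_castLE ω x le_rfl _

theorem sum_snoc [Fintype X] {T : ℕ} (F : (Fin (T + 1) → X) → ℝ) :
    ∑ ω, F ω = ∑ ω : Fin T → X, ∑ x, F (Fin.snoc (α := fun _ => X) ω x) := by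
  rw [← (Fin.snocEquiv (fun _ : Fin (T + 1) => X)).sum_comp, Fintype.sum_prod_type_right]
  rfl

/-- Conditioning on the first `T` terms; every supermartingale and normalisation argument below
rests on this identity. -/
theorem sum_seqProb_succ [Fintype X] (k : (t : ℕ) → (Fin t → X) → X → ℝ) (T : ℕ)
    (F : (Fin (T + 1) → X) → ℝ) :
    ∑ ω, seqProb k (T + 1) ω * F ω =
      ∑ ω, seqProb k T ω * ∑ x, k T ω x * F (Fin.snoc (α := fun _ => X) ω x) := by
  rw [sum_snoc]
  refine Finset.sum_congr rfl fun ω _ => ?_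
  rw [Finset.mul_sum]
  refine Finset.sum_congr rfl fun x _ => ?_
  rw [seqProb_snoc]
  ring

theorem seqProb_nonneg {k : (t : ℕ) → (Fin t → X) → X → ℝ} (hk : ∀ t ω x, 0 ≤ k t ω x) (T : ℕ) (ω : Fin T → X) :
    0 ≤ seqProb k T ω := Finset.prod_nonneg fun _ _ => hk _ _ _

variable [Fintype X] {k : (t : ℕ) → (Fin t → X) → X → ℝ}

theorem sum_seqProb (hk1 : ∀ t ω, ∑ x, k t ω x = 1) (T : ℕ) : ∑ ω, seqProb k T ω = 1 := by
  induction T with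
  | zero => simp [seqProb]
  | succ T ih =>
    have := sum_seqProb_succ k T (fun _ => 1)
    simpa [hk1, ih] using this

/-- **Ville's inequality** for nonnegative supermartingales over finite sequences. -/
theorem ville (hk : ∀ t ω x, 0 ≤ k t ω x) (hk1 : ∀ t ω, ∑ x, k t ω x = 1)
    (F : (t : ℕ) → (Fin t → X) → ℝ) (hF : ∀ t ω, 0 ≤ F t ω) (T : ℕ)
    (hsup : ∀ t < T, ∀ ω : Fin t → X,
      ∑ x, k t ω x * F (t + 1) (Fin.snoc (α := fun _ => X) ω x) ≤ F t ω)
    {b c : ℝ} (h0 : ∀ ω, F 0 ω ≤ b) (hc : 0 < c) :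
    ∑ ω, Set.indicator {ω : Fin T → X | ∃ (t : ℕ) (ht : t ≤ T),
      c ≤ F t (fun i => ω (i.castLE ht))} (seqProb k T) ω ≤ b / c := by
  classical
  let cross : (t : ℕ) → (Fin t → X) → Prop := fun t ω =>
    ∃ (s : ℕ) (hs : s ≤ t), c ≤ F s (fun i => ω (i.castLE hs))
  -- The process is frozen at the level `c`, not at its value when crossing. That value is at least
  -- `c`, so freezing only lowers it and the supermartingale property survives.
  let G : (t : ℕ) → (Fin t → X) → ℝ := fun t ω => if cross t ω then c else F t ω
  have hstep : ∀ t < T, ∀ ω : Fin t → X,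
      ∑ x, k t ω x * G (t + 1) (Fin.snoc (α := fun _ => X) ω x) ≤ G t ω := by
    intro t ht ω
    by_cases hcr : cross t ω
    · have : ∀ x, G (t + 1) (Fin.snoc (α := fun _ => X) ω x) = c := by
        intro x
        obtain ⟨s, hs, hh⟩ := hcr
        refine if_pos ⟨s, hs.trans (Nat.le_succ t), ?_⟩
        rw [snoc_castLE ω x hs]
        exact hh
      simp only [this, G, if_pos hcr]
      rw [← Finset.sum_mul, hk1, one_mul]
    · have hG : G t ω = F t ω := if_neg hcr
      rw [hG]
      refine le_trans (Finset.sum_le_sum fun x _ => ?_) (hsup t ht ω)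
      refine mul_le_mul_of_nonneg_left ?_ (hk _ _ _)
      by_cases hx : cross (t + 1) (Fin.snoc (α := fun _ => X) ω x)
      · simp only [G, if_pos hx]
        obtain ⟨s, hs, hh⟩ := hx
        rcases Nat.lt_or_ge t s with h | h
        · obtain rfl : s = t + 1 := le_antisymm hs h
          exact hh
        · rw [snoc_castLE ω x h] at hh
          exact absurd ⟨s, h, hh⟩ hcr
      · simp only [G, if_neg hx, le_refl]
  have hE : ∀ t ≤ T, ∑ ω, seqProb k t ω * G t ω ≤ b := by
    intro t ht
    induction t with
    | zero =>
      have : ∀ ω : Fin 0 → X, G 0 ω ≤ b := by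
        intro ω
        by_cases hcr : cross 0 ω
        · simp only [G, if_pos hcr]
          obtain ⟨s, hs, hh⟩ := hcr
          obtain rfl : s = 0 := Nat.le_zero.mp hs
          exact hh.trans (h0 _)
        · simp only [G, if_neg hcr]
          exact h0 _
      simpa [seqProb] using this _
    | succ t ih =>
      rw [sum_seqProb_succ]
      refine le_trans (Finset.sum_le_sum fun ω _ => ?_) (ih (Nat.le_of_succ_le ht))
      exact mul_le_mul_of_nonneg_left (hstep t ht ω) (seqProb_nonneg hk _ _)
  rw [le_div_iff₀ hc, Finset.sum_mul]
  refine le_trans (Finset.sum_le_sum fun ω _ => ?_) (hE T le_rfl)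
  by_cases hcr : cross T ω
  · rw [Set.indicator_of_mem (by exact hcr)]
    simp only [G, if_pos hcr, le_refl]
  · rw [Set.indicator_of_notMem (by exact hcr), zero_mul]
    exact mul_nonneg (seqProb_nonneg hk _ _) (by simp only [G, if_neg hcr]; exact hF _ _)

/-- A Bernstein-type deviation inequality with a fixed parameter for adapted sums of terms in
`[-1, 1]`. -/
theorem sum_sub_expect_deviation (hk : ∀ t ω x, 0 ≤ k t ω x) (hk1 : ∀ t ω, ∑ x, k t ω x = 1)
    (g : (t : ℕ) → (Fin t → X) → X → ℝ) (T : ℕ) (hg : ∀ t < T, ∀ ω x, |g t ω x| ≤ 1)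
    {lam β : ℝ} (hl : 0 < lam) (hl1 : lam ≤ 1) :
    ∑ ω, Set.indicator {ω : Fin T → X |
        lam * (∑ t : Fin T, ∑ x, k t (fun i => ω (i.castLE t.isLt.le)) x *
          |g t (fun i => ω (i.castLE t.isLt.le)) x|) + β / lam ≤
        ∑ t : Fin T, (g t (fun i => ω (i.castLE t.isLt.le)) (ω t) -
          ∑ x, k t (fun i => ω (i.castLE t.isLt.le)) x *
            g t (fun i => ω (i.castLE t.isLt.le)) x)} (seqProb k T) ω ≤ Real.exp (-β) := by
  -- Increment of the exponent of the supermartingale. The compensator uses the conditional mean of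
  -- `|g|`, which dominates that of `g ^ 2` because `|g| ≤ 1`; for indicators it is the visitation
  -- probability itself.
  let z : (t : ℕ) → (Fin t → X) → X → ℝ := fun t ω x =>
    lam * (g t ω x - ∑ y, k t ω y * g t ω y) - lam ^ 2 * ∑ y, k t ω y * |g t ω y|
  let F : (t : ℕ) → (Fin t → X) → ℝ := fun t ω =>
    Real.exp (∑ i : Fin t, z i (fun j => ω (j.castLE i.isLt.le)) (ω i))
  have hsnoc : ∀ t (ω : Fin t → X) x, F (t + 1) (Fin.snoc (α := fun _ => X) ω x) =
      F t ω * Real.exp (z t ω x) := by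
    intro t ω x
    simp only [F]
    rw [← Real.exp_add, Fin.sum_univ_castSucc]
    congr 2
    · refine Finset.sum_congr rfl fun i _ => ?_
      rw [Fin.snoc_castSucc]
      congr 1
      exact snoc_castLE ω x i.isLt.le _
    · rw [Fin.snoc_last]
      congr 1
      exact snoc_castLE ω x le_rfl _
  have hsup : ∀ t < T, ∀ ω : Fin t → X,
      ∑ x, k t ω x * F (t + 1) (Fin.snoc (α := fun _ => X) ω x) ≤ F t ω := by
    intro t ht ω
    set m := ∑ y, k t ω y * g t ω y with hm
    set v := ∑ y, k t ω y * |g t ω y| with hv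
    have h1 : ∀ x, Real.exp (lam * g t ω x) ≤ 1 + lam * g t ω x + lam ^ 2 * |g t ω x| := by
      intro x
      have hx := hg t ht ω x
      have hx1 : |lam * g t ω x| ≤ 1 := by
        rw [abs_mul, abs_of_pos hl]
        exact mul_le_one₀ hl1 (abs_nonneg _) hx
      have := (abs_le.mp (Real.abs_exp_sub_one_sub_id_le hx1)).2
      have h2 : (lam * g t ω x) ^ 2 ≤ lam ^ 2 * |g t ω x| := by
        rw [mul_pow, ← sq_abs (g t ω x)]
        refine mul_le_mul_of_nonneg_left ?_ (sq_nonneg _)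
        nlinarith [abs_nonneg (g t ω x)]
      linarith
    have h2 : ∑ x, k t ω x * Real.exp (lam * g t ω x) ≤ Real.exp (lam * m + lam ^ 2 * v) := by
      calc ∑ x, k t ω x * Real.exp (lam * g t ω x)
          ≤ ∑ x, k t ω x * (1 + lam * g t ω x + lam ^ 2 * |g t ω x|) :=
            Finset.sum_le_sum fun x _ => mul_le_mul_of_nonneg_left (h1 x) (hk _ _ _)
        _ = 1 + (lam * m + lam ^ 2 * v) := by
            rw [hm, hv, Finset.mul_sum, Finset.mul_sum]
            nth_rewrite 2 [← hk1 t ω]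
            rw [← Finset.sum_add_distrib, ← Finset.sum_add_distrib]
            exact Finset.sum_congr rfl fun x _ => by ring
        _ ≤ _ := by
            have := Real.add_one_le_exp (lam * m + lam ^ 2 * v)
            linarith
    calc ∑ x, k t ω x * F (t + 1) (Fin.snoc (α := fun _ => X) ω x)
        = F t ω * Real.exp (-(lam * m + lam ^ 2 * v)) *
            ∑ x, k t ω x * Real.exp (lam * g t ω x) := by
          rw [Finset.mul_sum]
          refine Finset.sum_congr rfl fun x _ => ?_
          rw [hsnoc]
          have : z t ω x = -(lam * m + lam ^ 2 * v) + lam * g t ω x := by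
            simp only [z, ← hm, ← hv]; ring
          rw [this, Real.exp_add]
          ring
      _ ≤ F t ω * Real.exp (-(lam * m + lam ^ 2 * v)) * Real.exp (lam * m + lam ^ 2 * v) :=
          mul_le_mul_of_nonneg_left h2 (mul_nonneg (Real.exp_pos _).le (Real.exp_pos _).le)
      _ = F t ω := by rw [mul_assoc, ← Real.exp_add]; simp
  have hV := ville hk hk1 F (fun _ _ => (Real.exp_pos _).le) T hsup (b := 1) (c := Real.exp β)
    (fun ω => by simp [F]) (Real.exp_pos _)
  rw [Real.exp_neg, ← one_div]
  refine le_trans (Finset.sum_le_sum fun ω _ => ?_) hV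
  refine Set.indicator_le_indicator_of_subset (fun ω hω => ?_) (fun ω => seqProb_nonneg hk _ _) ω
  -- Only a crossing at the final time is needed here.
  refine ⟨T, le_rfl, ?_⟩
  refine Real.exp_le_exp.mpr ?_
  have h := mul_le_mul_of_nonneg_left (show _ ≤ _ from hω) hl.le
  simp only [z, Finset.sum_sub_distrib, ← Finset.mul_sum]
  rw [mul_add, mul_div_cancel₀ _ hl.ne', Finset.sum_sub_distrib] at h
  simp only [Fin.castLE_rfl, id]
  linarith

end Sequences

/-! ### Laws of episodes under Markovian and general policies. -/

section EpisodeLaws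

variable {S A : Type*} [Fintype S] [DecidableEq S] [Fintype A] {H : ℕ}

/-- The law of an episode when the action at each step is drawn from a distribution that may
depend on the past state-action pairs. -/
def historyLaw (p : Fin H → S → A → S → ℝ) (c : (h : Fin H) → (Fin h → S × A) → S → A → ℝ)
    (s₀ : S) (m : Episode S A H) : ℝ :=
  ((if m.1 0 = s₀ then 1 else 0) *
    ∏ h : Fin H, p h (m.1 h.castSucc) (m.2 h) (m.1 h.succ)) *
    ∏ h : Fin H, c h (fun i => m.pair (i.castLE h.isLt.le)) (m.1 h.castSucc) (m.2 h)

/-- Append an action and a next state to an episode. -/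
def Episode.snoc {S A : Type*} {H : ℕ} (m : Episode S A H) (a : A) (s : S) :
    Episode S A (H + 1) :=
  (Fin.snoc (α := fun _ => S) m.1 s, Fin.snoc (α := fun _ => A) m.2 a)

theorem Episode.snoc_fst_castSucc {S A : Type*} {H : ℕ} (m : Episode S A H) (a : A) (s : S)
    (i : Fin (H + 1)) : (m.snoc a s).1 i.castSucc = m.1 i := by
  simp only [Episode.snoc, Fin.snoc_castSucc]

theorem Episode.snoc_fst_last {S A : Type*} {H : ℕ} (m : Episode S A H) (a : A) (s : S) :
    (m.snoc a s).1 (Fin.last (H + 1)) = s := by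
  simp only [Episode.snoc, Fin.snoc_last]

theorem Episode.snoc_snd_castSucc {S A : Type*} {H : ℕ} (m : Episode S A H) (a : A) (s : S)
    (i : Fin H) : (m.snoc a s).2 i.castSucc = m.2 i := by
  simp only [Episode.snoc, Fin.snoc_castSucc]

theorem Episode.snoc_snd_last {S A : Type*} {H : ℕ} (m : Episode S A H) (a : A) (s : S) :
    (m.snoc a s).2 (Fin.last H) = a := by
  simp only [Episode.snoc, Fin.snoc_last]

theorem Episode.snoc_pair_castSucc {S A : Type*} {H : ℕ} (m : Episode S A H) (a : A) (s : S)
    (i : Fin H) : (m.snoc a s).pair i.castSucc = m.pair i := by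
  simp only [Episode.pair, Episode.snoc_fst_castSucc, Episode.snoc_snd_castSucc]

theorem historyLaw_snoc (p : Fin (H + 1) → S → A → S → ℝ)
    (c : (h : Fin (H + 1)) → (Fin h → S × A) → S → A → ℝ) (s₀ : S) (m : Episode S A H)
    (a : A) (s : S) :
    historyLaw p c s₀ (m.snoc a s) =
      historyLaw (fun h => p h.castSucc) (fun h => c h.castSucc) s₀ m *
        (c (Fin.last H) m.pair (m.1 (Fin.last H)) a *
          p (Fin.last H) (m.1 (Fin.last H)) a s) := by
  have h0 : (m.snoc a s).1 0 = m.1 0 := m.snoc_fst_castSucc a s 0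
  have hc : ∀ h : Fin H, (m.snoc a s).1 h.castSucc.succ = m.1 h.succ := fun h => by
    rw [Fin.succ_castSucc, Episode.snoc_fst_castSucc]
  have hl : (m.snoc a s).1 (Fin.last H).succ = s := m.snoc_fst_last a s
  have hp : ∀ h : Fin H, (fun i : Fin h => (m.snoc a s).pair
      (i.castLE h.castSucc.isLt.le)) = fun i => m.pair (i.castLE h.isLt.le) := fun h => by
    funext i
    exact m.snoc_pair_castSucc a s (i.castLE h.isLt.le)
  have hpl : (fun i : Fin H => (m.snoc a s).pair (i.castLE (Fin.last H).isLt.le)) = m.pair := by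
    funext i
    exact m.snoc_pair_castSucc a s _
  unfold historyLaw
  rw [Fin.prod_univ_castSucc, Fin.prod_univ_castSucc, h0]
  simp only [Episode.snoc_fst_castSucc, Episode.snoc_snd_castSucc, hc, hl,
    Episode.snoc_snd_last]
  have e1 : ∀ h : Fin H, c h.castSucc (fun i => (m.snoc a s).pair
      (i.castLE h.castSucc.isLt.le)) (m.1 h.castSucc) (m.2 h) =
      c h.castSucc (fun i : Fin h => m.pair (i.castLE h.isLt.le)) (m.1 h.castSucc) (m.2 h) :=
    fun h => congrArg (fun f => c h.castSucc f (m.1 h.castSucc) (m.2 h)) (hp h)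
  have e2 : c (Fin.last H) (fun i => (m.snoc a s).pair (i.castLE (Fin.last H).isLt.le))
      (m.1 (Fin.last H)) a = c (Fin.last H) m.pair (m.1 (Fin.last H)) a :=
    congrArg (fun f => c (Fin.last H) f (m.1 (Fin.last H)) a) hpl
  rw [Finset.prod_congr rfl fun h _ => e1 h, e2]
  ring

theorem sum_episode_snoc (F : Episode S A (H + 1) → ℝ) :
    ∑ m, F m = ∑ m : Episode S A H, ∑ a, ∑ s, F (m.snoc a s) := by
  rw [Fintype.sum_prod_type, Fintype.sum_prod_type, sum_snoc]
  refine Finset.sum_congr rfl fun x _ => ?_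
  simp_rw [sum_snoc]
  rw [Finset.sum_comm]
  refine Finset.sum_congr rfl fun y _ => ?_
  rw [Finset.sum_comm]
  rfl

theorem sum_historyLaw_mul_succ (p : Fin (H + 1) → S → A → S → ℝ)
    (c : (h : Fin (H + 1)) → (Fin h → S × A) → S → A → ℝ) (s₀ : S)
    (F : Episode S A (H + 1) → ℝ) :
    ∑ m, historyLaw p c s₀ m * F m =
      ∑ m, historyLaw (fun h => p h.castSucc) (fun h => c h.castSucc) s₀ m *
        ∑ a, c (Fin.last H) m.pair (m.1 (Fin.last H)) a *
          ∑ s, p (Fin.last H) (m.1 (Fin.last H)) a s * F (m.snoc a s) := by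
  rw [sum_episode_snoc]
  refine Finset.sum_congr rfl fun m _ => ?_
  rw [Finset.mul_sum]
  refine Finset.sum_congr rfl fun a _ => ?_
  rw [Finset.mul_sum, Finset.mul_sum]
  refine Finset.sum_congr rfl fun s _ => ?_
  rw [historyLaw_snoc]
  ring

theorem sum_historyLaw (p : Fin H → S → A → S → ℝ)
    (c : (h : Fin H) → (Fin h → S × A) → S → A → ℝ) (s₀ : S)
    (hp : ∀ h s a, ∑ s', p h s a s' = 1) (hc : ∀ h σ s, ∑ a, c h σ s a = 1) :
    ∑ m, historyLaw p c s₀ m = 1 := by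
  induction H with
  | zero =>
    simp only [historyLaw, Finset.univ_eq_empty, Finset.prod_empty, mul_one]
    rw [Fintype.sum_prod_type]
    rw [← (Equiv.funUnique (Fin 1) S).symm.sum_comp]
    simp
  | succ H ih =>
    have := sum_historyLaw_mul_succ p c s₀ (fun _ => 1)
    simp only [mul_one, hp, hc] at this
    rw [this]
    exact ih _ _ (fun _ => hp _) (fun h σ s => hc h.castSucc σ s)

/-- Induction on the horizon. A transition at the last step is averaged directly; for an earlier
one, the appended action and state integrate to one on both sides. -/
theorem sum_historyLaw_mul_trans (p : Fin H → S → A → S → ℝ)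
    (c : (h : Fin H) → (Fin h → S × A) → S → A → ℝ) (s₀ : S)
    (hp : ∀ h s a, ∑ s', p h s a s' = 1) (hc : ∀ h σ s, ∑ a, c h σ s a = 1)
    (h : Fin H) (g : S → A → S → ℝ) :
    ∑ m, historyLaw p c s₀ m * g (m.1 h.castSucc) (m.2 h) (m.1 h.succ) =
      ∑ m, historyLaw p c s₀ m *
        ∑ s', p h (m.1 h.castSucc) (m.2 h) s' * g (m.1 h.castSucc) (m.2 h) s' := by
  induction H with
  | zero => exact h.elim0
  | succ H ih =>
    rw [sum_historyLaw_mul_succ, sum_historyLaw_mul_succ]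
    induction h using Fin.lastCases with
    | last =>
      refine Finset.sum_congr rfl fun m _ => ?_
      congr 1
      refine Finset.sum_congr rfl fun a _ => ?_
      congr 1
      simp only [Episode.snoc_fst_castSucc, Episode.snoc_snd_last]
      rw [← Finset.sum_mul, hp, one_mul]
      refine Finset.sum_congr rfl fun s _ => ?_
      congr 2
      exact m.snoc_fst_last a s
    | cast h =>
      have hs : ∀ (m : Episode S A H) a s, (m.snoc a s).1 h.castSucc.succ = m.1 h.succ :=
        fun m a s => by rw [Fin.succ_castSucc, Episode.snoc_fst_castSucc]
      simp only [Episode.snoc_fst_castSucc, Episode.snoc_snd_castSucc, hs]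
      simp only [← Finset.sum_mul, hp, hc, one_mul]
      exact ih (fun h => p h.castSucc) (fun h => c h.castSucc) (fun _ => hp _)
        (fun h σ s => hc h.castSucc σ s) h

/-- A probability law on episodes under which the episode starts in the initial state of `M` and
the states follow the transition kernels of `M`. -/
structure IsEpisodeLaw (M : MDP S A H) (q : Episode S A H → ℝ) : Prop where
  nonneg : ∀ m, 0 ≤ q m
  sum_one : ∑ m, q m = 1
  init : ∀ m, q m ≠ 0 → m.1 0 = M.init
  trans : ∀ (h : Fin H) (g : S → A → S → ℝ),
    ∑ m, q m * g (m.1 h.castSucc) (m.2 h) (m.1 h.succ) =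
      ∑ m, q m * ∑ s', M.p h (m.1 h.castSucc) (m.2 h) s' * g (m.1 h.castSucc) (m.2 h) s'

/-- This covers Markovian policies directly, and general policies once their noise is frozen. The
rest of the proof uses a policy's law mostly through `IsEpisodeLaw`. -/
theorem isEpisodeLaw_historyLaw (M : MDP S A H)
    (c : (h : Fin H) → (Fin h → S × A) → S → A → ℝ) (hc0 : ∀ h σ s a, 0 ≤ c h σ s a)
    (hc : ∀ h σ s, ∑ a, c h σ s a = 1) : IsEpisodeLaw M (historyLaw M.p c M.init) where
  nonneg m := by
    refine mul_nonneg (mul_nonneg ?_ (Finset.prod_nonneg fun h _ => (M.p_mem _ _ _).1 _))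
      (Finset.prod_nonneg fun h _ => hc0 _ _ _ _)
    split_ifs <;> norm_num
  sum_one := sum_historyLaw _ _ _ (fun h s a => (M.p_mem h s a).2) hc
  init m hm := by
    by_contra h
    exact hm (by simp [historyLaw, h])
  trans := sum_historyLaw_mul_trans _ _ _ (fun h s a => (M.p_mem h s a).2) hc

theorem MarkovPolicy.isEpisodeLaw (π : MarkovPolicy S A H) (M : MDP S A H) :
    IsEpisodeLaw M (π.law M) :=
  isEpisodeLaw_historyLaw M (fun h _ s a => π.prob h s a)
    (fun h _ s a => (π.prob_mem h s).1 a) (fun h _ s => (π.prob_mem h s).2)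

theorem GeneralPolicy.measurableSet_act [DecidableEq A] (ψ : GeneralPolicy S A H)
    (m : Episode S A H) (h : Fin H) :
    MeasurableSet {u : Fin H → unitInterval |
      ψ.act h (fun i => (m.pair (i.castLE h.isLt.le), u (i.castLE h.isLt.le)))
        (m.1 h.castSucc) (u h) = m.2 h} := by
  have hm : Measurable fun u : Fin H → unitInterval =>
      ((fun i : Fin h => u (i.castLE h.isLt.le)), u h) := by fun_prop
  exact hm (ψ.measurable_act h (fun i => m.pair (i.castLE h.isLt.le)) (m.1 h.castSucc) (m.2 h))

theorem GeneralPolicy.isEpisodeLaw [DecidableEq A] (ψ : GeneralPolicy S A H) (M : MDP S A H) :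
    IsEpisodeLaw M (ψ.law M) := by
  -- For fixed noise the policy is a deterministic function of the history. All properties in
  -- `IsEpisodeLaw` are preserved by averaging over the noise.
  let q : (Fin H → unitInterval) → Episode S A H → ℝ := fun u =>
    historyLaw M.p (fun h σ s a =>
      if ψ.act h (fun i => (σ i, u (i.castLE h.isLt.le))) s (u h) = a then 1 else 0) M.init
  have hq : ∀ u, IsEpisodeLaw M (q u) := fun u =>
    isEpisodeLaw_historyLaw M _ (fun h σ s a => by split_ifs <;> norm_num)
      (fun h σ s => by simp)
  have hlaw : ∀ m, ψ.law M m = ∫ u, q u m := fun m => rfl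
  have hint : ∀ m, MeasureTheory.Integrable (fun u => q u m) := by
    intro m
    have hmeas : Measurable fun u => q u m := by
      refine Measurable.const_mul ?_ _
      refine Finset.measurable_prod _ fun h _ => ?_
      exact Measurable.ite (ψ.measurableSet_act m h) measurable_const measurable_const
    refine MeasureTheory.Integrable.of_bound hmeas.aestronglyMeasurable 1
      (Filter.Eventually.of_forall fun u => ?_)
    rw [Real.norm_eq_abs, abs_of_nonneg ((hq u).nonneg m), ← (hq u).sum_one]
    exact Finset.single_le_sum (fun m _ => (hq u).nonneg m) (Finset.mem_univ m)
  have hsum : ∀ f : Episode S A H → ℝ, ∑ m, ψ.law M m * f m = ∫ u, ∑ m, q u m * f m := by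
    intro f
    rw [MeasureTheory.integral_finsetSum _ fun m _ => (hint m).mul_const _]
    refine Finset.sum_congr rfl fun m _ => ?_
    rw [hlaw, MeasureTheory.integral_mul_const]
  refine ⟨fun m => ?_, ?_, fun m hm => ?_, fun h g => ?_⟩
  · rw [hlaw]
    exact MeasureTheory.integral_nonneg fun u => (hq u).nonneg m
  · have := hsum fun _ => 1
    simp only [mul_one, (hq _).sum_one] at this
    simpa using this
  · by_contra h
    refine hm ?_
    rw [hlaw]
    have : ∀ u, q u m = 0 := fun u => by
      by_contra hu
      exact h ((hq u).init m hu)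
    simp [this]
  · rw [hsum, hsum fun m => ∑ s', M.p h (m.1 h.castSucc) (m.2 h) s' *
      g (m.1 h.castSucc) (m.2 h) s']
    simp only [(hq _).trans h g]

variable [DecidableEq A]

/-- Translates between expectations over episodes and sums against the visitation distribution. -/
theorem sum_visitation_mul (q : Episode S A H → ℝ) (h : Fin H) (f : S × A → ℝ) :
    ∑ x, visitation q h x * f x = ∑ m, q m * f (m.pair h) := by
  simp only [visitation, Finset.sum_mul]
  rw [Finset.sum_comm]
  refine Finset.sum_congr rfl fun m _ => ?_
  simp

theorem visitation_nonneg {M : MDP S A H} {q : Episode S A H → ℝ} (hq : IsEpisodeLaw M q)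
    (h : Fin H) (x : S × A) : 0 ≤ visitation q h x :=
  Finset.sum_nonneg fun m _ => by split_ifs; exacts [hq.nonneg m, le_rfl]

theorem sum_visitation {M : MDP S A H} {q : Episode S A H → ℝ} (hq : IsEpisodeLaw M q)
    (h : Fin H) : ∑ x, visitation q h x = 1 := by
  have := sum_visitation_mul q h fun _ => 1
  simpa [hq.sum_one] using this

end EpisodeLaws

/-! ### Laplace rule, Hellinger distance and entropy inequalities. -/

section Information

variable {ι : Type*} [Fintype ι]

open Nat in
/-- The probability that the Laplace (add-one) rule assigns to a sequence with counts `N`. -/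
def laplaceProb (N : ι → ℕ) : ℝ :=
  (∏ i, ((N i)! : ℝ)) * ((Fintype.card ι - 1)! : ℝ) / ((∑ i, N i + (Fintype.card ι - 1))! : ℝ)

theorem laplaceProb_pos (N : ι → ℕ) : 0 < laplaceProb N := by
  unfold laplaceProb
  have : 0 < ∏ i, ((N i).factorial : ℝ) :=
    Finset.prod_pos fun i _ => by exact_mod_cast Nat.factorial_pos _
  have h1 : (0 : ℝ) < ((Fintype.card ι - 1).factorial : ℝ) := by
    exact_mod_cast Nat.factorial_pos _
  have h2 : (0 : ℝ) < ((∑ i, N i + (Fintype.card ι - 1)).factorial : ℝ) := by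
    exact_mod_cast Nat.factorial_pos _
  positivity

theorem laplaceProb_zero : laplaceProb (fun _ : ι => 0) = 1 := by
  have h1 : ((Fintype.card ι - 1).factorial : ℝ) ≠ 0 := by
    exact_mod_cast (Nat.factorial_pos _).ne'
  simp [laplaceProb, h1]

/-- The add-one prediction is the ratio of successive values of `laplaceProb`, so products of
predictions telescope. -/
theorem laplaceProb_add_single [DecidableEq ι] (N : ι → ℕ) (i : ι) :
    laplaceProb (fun j => N j + if j = i then 1 else 0) =
      laplaceProb N * ((N i + 1) / (∑ j, N j + Fintype.card ι)) := by
  have hcard : 0 < Fintype.card ι := Fintype.card_pos_iff.mpr ⟨i⟩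
  have h1 : ∑ j, (N j + if j = i then 1 else 0) = ∑ j, N j + 1 := by
    rw [Finset.sum_add_distrib]; simp
  have h2 : ∏ j, ((N j + if j = i then 1 else 0).factorial : ℝ) =
      (∏ j, ((N j).factorial : ℝ)) * (N i + 1) := by
    have : ∀ j, ((N j + if j = i then 1 else 0).factorial : ℝ) =
        ((N j).factorial : ℝ) * if j = i then ((N i : ℝ) + 1) else 1 := by
      intro j
      split_ifs with h
      · subst h
        rw [Nat.factorial_succ]; push_cast; ring
      · simp
    simp_rw [this]
    rw [Finset.prod_mul_distrib]; simp
  have h3 : ∑ j, N j + 1 + (Fintype.card ι - 1) = (∑ j, N j + (Fintype.card ι - 1)) + 1 := by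
    ring
  unfold laplaceProb
  rw [h1, h2, h3, Nat.factorial_succ]
  have h4 : ((∑ j, N j + (Fintype.card ι - 1) + 1 : ℕ) : ℝ) = ∑ j, (N j : ℝ) + Fintype.card ι := by
    rw [add_assoc, Nat.sub_add_cancel hcard]; push_cast; rfl
  rw [Nat.cast_mul, h4]
  have h5 : ((∑ j, N j + (Fintype.card ι - 1)).factorial : ℝ) ≠ 0 := by
    exact_mod_cast (Nat.factorial_pos _).ne'
  have h6 : (∑ j, (N j : ℝ) + Fintype.card ι) ≠ 0 := by
    have : (0 : ℝ) < Fintype.card ι := by exact_mod_cast hcard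
    positivity
  push_cast
  field_simp

/-- The multinomial coefficient times the product of the `N i ^ N i` is a single term of the
multinomial expansion of `(∑ N i) ^ (∑ N i)`. -/
theorem factorial_mul_prod_pow_le [DecidableEq ι] (N : ι → ℕ) :
    (∑ i, N i).factorial * ∏ i, N i ^ N i ≤ (∑ i, N i) ^ (∑ i, N i) * ∏ i, (N i).factorial := by
  have h := Finset.sum_pow_eq_sum_piAntidiag (R := ℕ) Finset.univ N (∑ i, N i)
  have hmem : N ∈ Finset.piAntidiag Finset.univ (∑ i, N i) := by simp
  have h1 : Nat.multinomial Finset.univ N * ∏ i, N i ^ N i ≤ (∑ i, N i) ^ (∑ i, N i) := by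
    rw [h]
    exact Finset.single_le_sum (f := fun k => (Nat.multinomial Finset.univ k : ℕ) *
      ∏ i, N i ^ k i) (fun _ _ => Nat.zero_le _) hmem
  have h2 := Nat.multinomial_spec Finset.univ N
  calc (∑ i, N i).factorial * ∏ i, N i ^ N i
      = (Nat.multinomial Finset.univ N * ∏ i, N i ^ N i) * ∏ i, (N i).factorial := by
        rw [← h2]; ring
    _ ≤ _ := Nat.mul_le_mul_right _ h1

theorem factorial_add_le (n k : ℕ) :
    (n + k).factorial ≤ n.factorial * k.factorial * (n + 1) ^ k := by
  induction k with
  | zero => simp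
  | succ k ih =>
    rw [← add_assoc, Nat.factorial_succ, Nat.factorial_succ]
    calc (n + k + 1) * (n + k).factorial
        ≤ ((k + 1) * (n + 1)) * (n.factorial * k.factorial * (n + 1) ^ k) :=
          Nat.mul_le_mul (by nlinarith) ih
      _ = _ := by ring

/-- The regret of the Laplace rule against the empirical distribution. -/
theorem sum_mul_log_empirical_le (N : ι → ℕ) :
    ∑ i, (N i : ℝ) * Real.log (N i / (∑ j, N j : ℕ)) ≤
      (Fintype.card ι - 1 : ℕ) * Real.log ((∑ j, N j : ℕ) + 1) + Real.log (laplaceProb N) := by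
  classical
  set n := ∑ j, N j with hn
  rcases Nat.eq_zero_or_pos n with h0 | hpos
  · have hN : N = fun _ => 0 := by
      funext i
      exact (Finset.sum_eq_zero_iff.mp (hn.symm.trans h0)) i (Finset.mem_univ i)
    rw [h0, hN, laplaceProb_zero]
    simp
  have hnR : (0 : ℝ) < n := by exact_mod_cast hpos
  have hf : ∀ k : ℕ, (0 : ℝ) < k.factorial := fun k => by exact_mod_cast Nat.factorial_pos k
  have hpf : 0 < ∏ i, ((N i).factorial : ℝ) := Finset.prod_pos fun i _ => hf _
  have hNpow : ∀ i, (0 : ℝ) < (N i : ℝ) ^ N i := by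
    intro i
    rcases Nat.eq_zero_or_pos (N i) with h | h
    · rw [h]; norm_num
    · have : (0 : ℝ) < N i := by exact_mod_cast h
      positivity
  -- The maximum likelihood of the sequence is at most the inverse multinomial coefficient; `hB`
  -- then bounds the remaining binomial factor by a power of `n + 1`.
  have hA : (n.factorial : ℝ) * ∏ i, (N i : ℝ) ^ N i ≤ (n : ℝ) ^ n * ∏ i, ((N i).factorial : ℝ) := by
    exact_mod_cast factorial_mul_prod_pow_le N
  have hB : ((n + (Fintype.card ι - 1)).factorial : ℝ) ≤
      n.factorial * (Fintype.card ι - 1).factorial * ((n : ℝ) + 1) ^ (Fintype.card ι - 1) := by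
    exact_mod_cast factorial_add_le n (Fintype.card ι - 1)
  have hlog : ∑ i, (N i : ℝ) * Real.log (N i / n) =
      Real.log ((∏ i, (N i : ℝ) ^ N i) / (n : ℝ) ^ n) := by
    rw [Real.log_div (Finset.prod_pos fun i _ => hNpow i).ne' (by positivity),
      Real.log_prod fun i _ => (hNpow i).ne', Real.log_pow, hn]
    push_cast
    rw [Finset.sum_mul, ← Finset.sum_sub_distrib]
    refine Finset.sum_congr rfl fun i _ => ?_
    rw [Real.log_pow]
    rcases Nat.eq_zero_or_pos (N i) with h | h
    · simp [h]
    · have h' : (0 : ℝ) < N i := by exact_mod_cast h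
      have hn' : (∑ j, (N j : ℝ)) ≠ 0 := by
        have := hnR.ne'
        rw [hn] at this
        exact_mod_cast this
      rw [Real.log_div h'.ne' hn']
      ring
  rw [hlog, ← Real.log_pow, ← Real.log_mul (by positivity) (laplaceProb_pos N).ne']
  refine Real.log_le_log (div_pos (Finset.prod_pos fun i _ => hNpow i) (by positivity)) ?_
  unfold laplaceProb
  rw [← hn, ← mul_div_assoc, div_le_div_iff₀ (by positivity) (hf _)]
  have hPN : 0 < ∏ i, (N i : ℝ) ^ N i := Finset.prod_pos fun i _ => hNpow i
  calc (∏ i, (N i : ℝ) ^ N i) * ((n + (Fintype.card ι - 1)).factorial : ℝ)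
      ≤ (∏ i, (N i : ℝ) ^ N i) * (n.factorial * (Fintype.card ι - 1).factorial *
          ((n : ℝ) + 1) ^ (Fintype.card ι - 1)) := mul_le_mul_of_nonneg_left hB hPN.le
    _ = ((n.factorial : ℝ) * ∏ i, (N i : ℝ) ^ N i) * ((Fintype.card ι - 1).factorial *
          ((n : ℝ) + 1) ^ (Fintype.card ι - 1)) := by ring
    _ ≤ ((n : ℝ) ^ n * ∏ i, ((N i).factorial : ℝ)) * ((Fintype.card ι - 1).factorial *
          ((n : ℝ) + 1) ^ (Fintype.card ι - 1)) :=
        mul_le_mul_of_nonneg_right hA (by positivity)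
    _ = _ := by ring

/-- The squared Hellinger distance is at most the Kullback-Leibler divergence. -/
theorem hellinger_le_kl {p q : ι → ℝ} (hp : p ∈ stdSimplex ℝ ι) (hq : q ∈ stdSimplex ℝ ι)
    (hac : ∀ i, q i ≠ 0 → p i ≠ 0) :
    ∑ i, (Real.sqrt (q i) - Real.sqrt (p i)) ^ 2 ≤ ∑ i, q i * Real.log (q i / p i) := by
  have h : ∀ i, (Real.sqrt (q i) - Real.sqrt (p i)) ^ 2 - (p i - q i) ≤
      q i * Real.log (q i / p i) := by
    intro i
    have hs : (Real.sqrt (q i) - Real.sqrt (p i)) ^ 2 =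
        q i + p i - 2 * (Real.sqrt (q i) * Real.sqrt (p i)) := by
      rw [sub_sq, Real.sq_sqrt (hp.1 i), Real.sq_sqrt (hq.1 i)]; ring
    rcases (hq.1 i).eq_or_lt with h0 | hpos
    · rw [← h0]; simp [Real.sq_sqrt (hp.1 i)]
    have hp' : 0 < p i := lt_of_le_of_ne (hp.1 i) (hac i hpos.ne').symm
    have hsq := Real.sqrt_pos.mpr hpos
    have hsp := Real.sqrt_pos.mpr hp'
    have h1 : Real.log (p i / q i) = 2 * Real.log (Real.sqrt (p i) / Real.sqrt (q i)) := by
      rw [← Real.sqrt_div hp'.le, Real.log_sqrt (by positivity)]; ring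
    have h2 := Real.log_le_sub_one_of_pos (div_pos hsp hsq)
    have h3 : Real.log (q i / p i) = - Real.log (p i / q i) := by
      rw [← Real.log_inv, inv_div]
    have h4 : q i * (Real.sqrt (p i) / Real.sqrt (q i)) = Real.sqrt (q i) * Real.sqrt (p i) := by
      nth_rewrite 1 [← Real.mul_self_sqrt hpos.le]
      field_simp
    have h5 := mul_le_mul_of_nonneg_left h2 hpos.le
    rw [mul_sub, h4] at h5
    rw [hs, h3, h1]
    linarith
  have := Finset.sum_le_sum fun i (_ : i ∈ Finset.univ) => h i
  rw [Finset.sum_sub_distrib, Finset.sum_sub_distrib, hp.2, hq.2] at this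
  linarith

/-- Cauchy–Schwarz applied to `q - p = (√q - √p)(√q + √p)`. The first factor is controlled by the
Hellinger distance, hence by the KL divergence, without reference to `V`. -/
theorem abs_sum_sub_mul_le {p q V : ι → ℝ} {R K : ℝ} (hp : p ∈ stdSimplex ℝ ι)
    (hq : q ∈ stdSimplex ℝ ι) (hac : ∀ i, q i ≠ 0 → p i ≠ 0)
    (hK : ∑ i, q i * Real.log (q i / p i) ≤ K) (hV0 : ∀ i, 0 ≤ V i) (hV : ∀ i, V i ≤ R)
    (hR : 0 ≤ R) : |∑ i, (q i - p i) * V i| ≤ R * Real.sqrt K := by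
  have hH := (hellinger_le_kl hp hq hac).trans hK
  have hc : ∑ i, (q i - p i) * V i = ∑ i, (Real.sqrt (q i) - Real.sqrt (p i)) *
      ((Real.sqrt (q i) + Real.sqrt (p i)) * (V i - R / 2)) := by
    -- Centring `V` at `R / 2` is free, as `p` and `q` have equal mass. It offsets the factor 4
    -- coming from `(√q + √p)² ≤ 2 (q + p)`, so the constant is exactly `R`.
    have h1 : ∑ i, (q i - p i) * V i = ∑ i, (q i - p i) * (V i - R / 2) := by
      simp_rw [mul_sub]
      rw [Finset.sum_sub_distrib, ← Finset.sum_mul, Finset.sum_sub_distrib, hq.2, hp.2]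
      ring
    rw [h1]
    refine Finset.sum_congr rfl fun i _ => ?_
    nth_rewrite 1 [← Real.sq_sqrt (hq.1 i), ← Real.sq_sqrt (hp.1 i)]
    ring
  have hb : ∑ i, ((Real.sqrt (q i) + Real.sqrt (p i)) * (V i - R / 2)) ^ 2 ≤ R ^ 2 := by
    have : ∀ i, ((Real.sqrt (q i) + Real.sqrt (p i)) * (V i - R / 2)) ^ 2 ≤
        (2 * (q i + p i)) * (R / 2) ^ 2 := by
      intro i
      rw [mul_pow]
      refine mul_le_mul ?_ ?_ (sq_nonneg _) ?_
      · nlinarith [sq_nonneg (Real.sqrt (q i) - Real.sqrt (p i)), Real.sq_sqrt (hq.1 i),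
          Real.sq_sqrt (hp.1 i)]
      · rw [sq_le_sq, abs_of_nonneg (by positivity : 0 ≤ R / 2), abs_le]
        constructor <;> linarith [hV0 i, hV i]
      · linarith [hq.1 i, hp.1 i]
    refine (Finset.sum_le_sum fun i _ => this i).trans ?_
    rw [← Finset.sum_mul, ← Finset.mul_sum, Finset.sum_add_distrib, hq.2, hp.2]
    apply le_of_eq; ring
  rw [hc]
  have hCS := Finset.sum_mul_sq_le_sq_mul_sq Finset.univ
    (fun i => Real.sqrt (q i) - Real.sqrt (p i))
    (fun i => (Real.sqrt (q i) + Real.sqrt (p i)) * (V i - R / 2))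
  have hK0 : 0 ≤ K := le_trans (Finset.sum_nonneg fun i _ => sq_nonneg _) hH
  refine abs_le_of_sq_le_sq ?_ (by positivity)
  rw [mul_pow, Real.sq_sqrt hK0, mul_comm]
  exact hCS.trans (mul_le_mul hH hb (Finset.sum_nonneg fun i _ => sq_nonneg _) hK0)

/-- Gibbs' inequality. -/
theorem sum_negMulLog_le {d q : ι → ℝ} (hd : ∀ i, 0 ≤ d i) (hq : ∀ i, 0 < q i)
    (hqd : ∑ i, q i ≤ ∑ i, d i) :
    ∑ i, Real.negMulLog (d i) ≤ ∑ i, d i * Real.log (1 / q i) := by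
  have h : ∀ i, Real.negMulLog (d i) ≤ d i * Real.log (1 / q i) + (q i - d i) := by
    intro i
    rcases (hd i).eq_or_lt with h0 | hpos
    · rw [← h0]; simp [(hq i).le]
    have h1 := Real.log_le_sub_one_of_pos (div_pos (hq i) hpos)
    have h2 := mul_le_mul_of_nonneg_left h1 hpos.le
    rw [mul_sub, mul_div_cancel₀ _ hpos.ne', Real.log_div (hq i).ne' hpos.ne'] at h2
    rw [Real.negMulLog, one_div, Real.log_inv]
    linarith
  have := Finset.sum_le_sum fun i (_ : i ∈ Finset.univ) => h i
  rw [Finset.sum_add_distrib, Finset.sum_sub_distrib] at this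
  linarith

theorem sum_negMulLog_le_log_card [Nonempty ι] {d : ι → ℝ} (hd : ∀ i, 0 ≤ d i)
    (hd1 : ∑ i, d i = 1) :
    ∑ i, Real.negMulLog (d i) ≤ Real.log (Fintype.card ι) := by
  have hc : (0 : ℝ) < Fintype.card ι := by exact_mod_cast Fintype.card_pos
  have := sum_negMulLog_le (q := fun _ => 1 / (Fintype.card ι : ℝ)) hd (fun _ => by positivity)
    (by rw [hd1]; simp [hc.ne'])
  rw [← Finset.sum_mul, hd1] at this
  simpa using this

/-- Smoothing a distribution by the Laplace rule changes its cross-entropy by little. -/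
theorem sum_mul_log_smoothed_le {D : ι → ℝ} {T : ℝ} (hT : 0 < T) (hD : ∀ i, 0 ≤ D i)
    (hDT : ∑ i, D i = T) :
    ∑ i, D i * Real.log ((T + Fintype.card ι) / (D i + 1)) ≤
      T * ∑ i, Real.negMulLog (D i / T) + Fintype.card ι := by
  have hk : (0 : ℝ) ≤ Fintype.card ι := Nat.cast_nonneg _
  have h : ∀ i, D i * Real.log ((T + Fintype.card ι) / (D i + 1)) ≤
      T * Real.negMulLog (D i / T) + D i * (Fintype.card ι / T) := by
    intro i
    rcases (hD i).eq_or_lt with h0 | hpos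
    · rw [← h0]; simp
    have h1 : T * Real.negMulLog (D i / T) = D i * Real.log (T / D i) := by
      rw [Real.negMulLog, ← inv_div (D i) T, Real.log_inv]
      field_simp
    rw [h1, ← mul_add]
    refine mul_le_mul_of_nonneg_left ?_ hpos.le
    have h2 : (T + Fintype.card ι) / (D i + 1) ≤ (T / D i) * ((T + Fintype.card ι) / T) := by
      rw [div_mul_div_cancel₀' hT.ne']
      exact div_le_div_of_nonneg_left (by positivity) hpos (by linarith)
    have h3 := Real.log_le_sub_one_of_pos (show 0 < (T + Fintype.card ι) / T by positivity)
    have h4 : (T + Fintype.card ι) / T - 1 = Fintype.card ι / T := by field_simp; ring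
    calc Real.log ((T + Fintype.card ι) / (D i + 1))
        ≤ Real.log ((T / D i) * ((T + Fintype.card ι) / T)) :=
          Real.log_le_log (by positivity) h2
      _ = Real.log (T / D i) + Real.log ((T + Fintype.card ι) / T) :=
          Real.log_mul (by positivity) (by positivity)
      _ ≤ _ := by linarith
  refine (Finset.sum_le_sum fun i _ => h i).trans ?_
  rw [Finset.sum_add_distrib, ← Finset.mul_sum, ← Finset.sum_mul, hDT, mul_div_cancel₀ _ hT.ne']

end Information

/-! ### Visit and transition counts. -/

section Counts

variable {S A : Type*} [DecidableEq S] [DecidableEq A] {H : ℕ}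

theorem card_filter_snoc {X : Type*} {t : ℕ} (ω : Fin t → X) (m : X) (P : X → Prop)
    [DecidablePred P] :
    (Finset.univ.filter fun i : Fin (t + 1) =>
      P ((Fin.snoc (α := fun _ => X) ω m : Fin (t + 1) → X) i)).card =
      (Finset.univ.filter fun i : Fin t => P (ω i)).card + if P m then 1 else 0 := by
  simp only [Finset.card_filter]
  rw [Fin.sum_univ_castSucc]
  simp only [Fin.snoc_castSucc, Fin.snoc_last]

theorem count_snoc {t : ℕ} (ω : Fin t → Episode S A H) (m : Episode S A H) (h : Fin H) (s : S)
    (a : A) :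
    count (Fin.snoc (α := fun _ => Episode S A H) ω m : Fin (t + 1) → Episode S A H) h s a =
      count ω h s a + if m.pair h = (s, a) then 1 else 0 :=
  card_filter_snoc ω m fun m => m.pair h = (s, a)

theorem transCount_snoc {t : ℕ} (ω : Fin t → Episode S A H) (m : Episode S A H) (h : Fin H)
    (s : S) (a : A) (s' : S) :
    transCount (Fin.snoc (α := fun _ => Episode S A H) ω m : Fin (t + 1) → Episode S A H)
        h s a s' =
      transCount ω h s a s' + if m.pair h = (s, a) ∧ m.1 h.succ = s' then 1 else 0 :=
  card_filter_snoc ω m fun m => m.pair h = (s, a) ∧ m.1 h.succ = s'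

theorem count_le {t : ℕ} (ω : Fin t → Episode S A H) (h : Fin H) (s : S) (a : A) :
    count ω h s a ≤ t := by
  unfold count
  refine (Finset.card_filter_le _ _).trans ?_
  simp

variable [Fintype S]

theorem sum_transCount {t : ℕ} (ω : Fin t → Episode S A H) (h : Fin H) (s : S) (a : A) :
    ∑ s', transCount ω h s a s' = count ω h s a := by
  unfold transCount count
  simp only [Finset.card_filter]
  rw [Finset.sum_comm]
  refine Finset.sum_congr rfl fun i _ => ?_
  by_cases hi : (ω i).pair h = (s, a) <;> simp [hi]

theorem empTrans_mem_stdSimplex {t : ℕ} (ω : Fin t → Episode S A H) (h : Fin H) (s : S) (a : A) :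
    empTrans ω h s a ∈ stdSimplex ℝ S := by
  unfold empTrans
  constructor
  · intro s'
    dsimp only
    split_ifs <;> positivity
  · split_ifs with hn
    · rw [← Finset.sum_div, ← Nat.cast_sum, sum_transCount, div_self]
      exact_mod_cast hn.ne'
    · have : (Fintype.card S : ℝ) ≠ 0 := by
        exact_mod_cast (Fintype.card_pos_iff.mpr ⟨s⟩).ne'
      simp [this]

variable [Fintype A]

theorem sum_count {t : ℕ} (ω : Fin t → Episode S A H) (h : Fin H) :
    ∑ x : S × A, count ω h x.1 x.2 = t := by
  unfold count
  simp only [Finset.card_filter]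
  rw [Finset.sum_comm]
  simp

end Counts

/-! ### Concentration of the empirical transitions by the method of mixtures. -/

section TransitionConcentration

variable {S A : Type*} [Fintype S] [DecidableEq S] [Fintype A] [DecidableEq A] {H : ℕ}

/-- The interaction of a sampling rule with an MDP as a sequence of kernels. -/
def SamplingRule.kernel (pol : SamplingRule S A H) (M : MDP S A H) (t : ℕ)
    (ω : Fin t → Episode S A H) (m : Episode S A H) : ℝ :=
  (pol t ω).law M m

theorem SamplingRule.kernel_nonneg (pol : SamplingRule S A H) (M : MDP S A H) (t : ℕ)
    (ω : Fin t → Episode S A H) (m : Episode S A H) : 0 ≤ pol.kernel M t ω m :=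
  ((pol t ω).isEpisodeLaw M).nonneg m

theorem SamplingRule.sum_kernel (pol : SamplingRule S A H) (M : MDP S A H) (t : ℕ)
    (ω : Fin t → Episode S A H) : ∑ m, pol.kernel M t ω m = 1 :=
  ((pol t ω).isEpisodeLaw M).sum_one

/-- The likelihood ratio between the Laplace rule and the true transition kernel at a
state-action pair, along the first `t` episodes. -/
def transRatio (M : MDP S A H) (h : Fin H) (s : S) (a : A) (t : ℕ)
    (ω : Fin t → Episode S A H) : ℝ :=
  laplaceProb (transCount ω h s a) / ∏ s', M.p h s a s' ^ transCount ω h s a s'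

theorem transRatio_nonneg (M : MDP S A H) (h : Fin H) (s : S) (a : A) (t : ℕ)
    (ω : Fin t → Episode S A H) : 0 ≤ transRatio M h s a t ω :=
  div_nonneg (laplaceProb_pos _).le
    (Finset.prod_nonneg fun s' _ => pow_nonneg ((M.p_mem h s a).1 s') _)

/-- An episode changes the ratio only if it visits `(s, a)` at step `h`, and then by the Laplace
prediction over the true probability. The visit is tested on components so that the factor has the
form required by `IsEpisodeLaw.trans`. -/
theorem transRatio_snoc (M : MDP S A H) (h : Fin H) (s : S) (a : A) (t : ℕ)
    (ω : Fin t → Episode S A H) (m : Episode S A H) :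
    transRatio M h s a (t + 1) (Fin.snoc (α := fun _ => Episode S A H) ω m) =
      transRatio M h s a t ω * if (m.1 h.castSucc, m.2 h) = (s, a) then
        (transCount ω h s a (m.1 h.succ) + 1) / (count ω h s a + Fintype.card S) /
          M.p h s a (m.1 h.succ) else 1 := by
  change _ = _ * if m.pair h = (s, a) then _ else _
  unfold transRatio
  by_cases hm : m.pair h = (s, a)
  · have h1 : transCount (Fin.snoc (α := fun _ => Episode S A H) ω m :
        Fin (t + 1) → Episode S A H) h s a =
        fun s' => transCount ω h s a s' + if s' = m.1 h.succ then 1 else 0 := by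
      funext s'
      rw [transCount_snoc]
      simp only [hm, true_and, eq_comm]
    have h2 : ∏ s', M.p h s a s' ^ (transCount ω h s a s' + if s' = m.1 h.succ then 1 else 0) =
        (∏ s', M.p h s a s' ^ transCount ω h s a s') * M.p h s a (m.1 h.succ) := by
      simp_rw [pow_add]
      rw [Finset.prod_mul_distrib]
      congr 1
      simp [pow_ite]
    rw [if_pos hm, h1, laplaceProb_add_single, h2, sum_transCount]
    rw [div_mul_div_comm]
  · have h1 : transCount (Fin.snoc (α := fun _ => Episode S A H) ω m :
        Fin (t + 1) → Episode S A H) h s a = transCount ω h s a := by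
      funext s'
      rw [transCount_snoc]
      simp [hm]
    rw [if_neg hm, h1, mul_one]

/-- Given a visit, the mean of the update factor is the Laplace mass of the states with positive
true probability, hence at most 1. The ratio is thus a nonnegative supermartingale started at 1. -/
theorem prob_transRatio_ge_le (M : MDP S A H) (pol : SamplingRule S A H) (h : Fin H) (s : S)
    (a : A) (T : ℕ) {K : ℝ} (hK : 0 < K) :
    ∑ ω, Set.indicator {ω : Fin T → Episode S A H | ∃ (t : ℕ) (ht : t ≤ T),
      K ≤ transRatio M h s a t (fun i => ω (i.castLE ht))} (seqProb (pol.kernel M) T) ω ≤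
      1 / K := by
  refine ville (pol.kernel_nonneg M) (pol.sum_kernel M) (transRatio M h s a)
    (transRatio_nonneg M h s a) T (fun t _ ω => ?_) (fun ω => ?_) hK
  · have hq := (pol t ω).isEpisodeLaw M
    have htr := hq.trans h fun s₁ a₁ s' => if (s₁, a₁) = (s, a) then
        ((transCount ω h s a s' : ℝ) + 1) / (count ω h s a + Fintype.card S) /
          M.p h s a s' else 1
    have hle : ∀ m : Episode S A H, ∑ s', M.p h (m.1 h.castSucc) (m.2 h) s' *
        (if (m.1 h.castSucc, m.2 h) = (s, a) then
        ((transCount ω h s a s' : ℝ) + 1) / (count ω h s a + Fintype.card S) /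
          M.p h s a s' else 1) ≤ 1 := by
      intro m
      by_cases hm : (m.1 h.castSucc, m.2 h) = (s, a)
      · simp only [hm, if_true]
        obtain ⟨h1, h2⟩ := Prod.mk.inj hm
        rw [h1, h2]
        have hS : (0 : ℝ) < Fintype.card S := by
          exact_mod_cast Fintype.card_pos_iff.mpr ⟨s⟩
        have hsum : ∑ s', ((transCount ω h s a s' : ℝ) + 1) /
            (count ω h s a + Fintype.card S) = 1 := by
          rw [← Finset.sum_div, Finset.sum_add_distrib, ← Nat.cast_sum, sum_transCount]
          simp only [Finset.sum_const, Finset.card_univ, nsmul_eq_mul, mul_one]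
          exact div_self (by positivity)
        refine le_of_le_of_eq ?_ hsum
        refine Finset.sum_le_sum fun s' _ => ?_
        -- At an impossible next state the division by zero gives 0 and the Laplace mass is lost, so
        -- there is only an inequality.
        rcases eq_or_ne (M.p h s a s') 0 with h0 | h0
        · rw [h0, zero_mul]; positivity
        · rw [mul_div_cancel₀ _ h0]
      · simp only [hm, if_false, mul_one]
        exact (M.p_mem _ _ _).2.le
    simp only [transRatio_snoc]
    calc ∑ m, pol.kernel M t ω m * (transRatio M h s a t ω *
          if (m.1 h.castSucc, m.2 h) = (s, a) then
          ((transCount ω h s a (m.1 h.succ) : ℝ) + 1) / (count ω h s a + Fintype.card S) /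
          M.p h s a (m.1 h.succ) else 1)
        = transRatio M h s a t ω * ∑ m, (pol t ω).law M m *
          (if (m.1 h.castSucc, m.2 h) = (s, a) then
          ((transCount ω h s a (m.1 h.succ) : ℝ) + 1) / (count ω h s a + Fintype.card S) /
          M.p h s a (m.1 h.succ) else 1) := by
          rw [Finset.mul_sum]
          refine Finset.sum_congr rfl fun m _ => ?_
          simp only [SamplingRule.kernel]
          ring
      _ ≤ transRatio M h s a t ω * 1 := by
          refine mul_le_mul_of_nonneg_left ?_ (transRatio_nonneg M h s a t ω)
          rw [htr]
          refine le_of_le_of_eq ?_ hq.sum_one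
          exact Finset.sum_le_sum fun m _ => mul_le_of_le_one_right (hq.nonneg m) (hle m)
      _ = _ := mul_one _
  · have h0 : ∀ s', transCount ω h s a s' = 0 := fun s' => by simp [transCount]
    have : transCount ω h s a = fun _ => 0 := funext h0
    simp [transRatio, this, laplaceProb_zero]

/-- Outside null runs only possible transitions are observed, so the empirical kernel is absolutely
continuous with respect to the true one, as the KL bound requires. -/
theorem trans_ne_zero_of_seqProb_ne_zero {M : MDP S A H} {pol : SamplingRule S A H} {T : ℕ}
    {ω : Fin T → Episode S A H} (hω : seqProb (pol.kernel M) T ω ≠ 0) (i : Fin T) (h : Fin H) :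
    M.p h ((ω i).1 h.castSucc) ((ω i).2 h) ((ω i).1 h.succ) ≠ 0 := by
  have h1 := (Finset.prod_ne_zero_iff.mp hω) i (Finset.mem_univ i)
  have h2 := left_ne_zero_of_mul h1
  have h3 := right_ne_zero_of_mul h2
  exact (Finset.prod_ne_zero_iff.mp h3) h (Finset.mem_univ h)

theorem alphaKL_ge {S A H : ℕ} {δ : ℝ} (n : ℕ) :
    Real.log (2 * S * A * H / δ) + (S - 1 : ℕ) * Real.log ((n : ℝ) + 1) ≤ alphaKL S A H δ n := by
  unfold alphaKL
  have h1 : Real.log ((n : ℝ) + 1) ≤ Real.log (Real.exp 1 * (1 + n)) := by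
    refine Real.log_le_log (by positivity) ?_
    have := Real.one_le_exp (show (0 : ℝ) ≤ 1 by norm_num)
    have hn : (0 : ℝ) ≤ n := Nat.cast_nonneg n
    nlinarith
  have h2 : (0 : ℝ) ≤ Real.log ((n : ℝ) + 1) :=
    Real.log_nonneg (by have : (0 : ℝ) ≤ n := Nat.cast_nonneg n
                        linarith)
  have h3 : ((S - 1 : ℕ) : ℝ) ≤ S := by exact_mod_cast Nat.sub_le _ _
  have := mul_le_mul h3 h1 h2 (Nat.cast_nonneg _)
  linarith

/-- Uniform control of the estimated expectations on the event that a likelihood ratio is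
small. -/
theorem abs_empTrans_sub_mul_le {M : MDP S A H} {t : ℕ} {ω : Fin t → Episode S A H} {h : Fin H}
    {s : S} {a : A} {δ : ℝ}
    (hsupp : ∀ i : Fin t, M.p h ((ω i).1 h.castSucc) ((ω i).2 h) ((ω i).1 h.succ) ≠ 0)
    (hratio : transRatio M h s a t ω < 2 * Fintype.card S * Fintype.card A * H / δ)
    (hn : 0 < count ω h s a) {V : S → ℝ} {R : ℝ} (hV0 : ∀ s', 0 ≤ V s') (hV : ∀ s', V s' ≤ R)
    (hR : 0 ≤ R) :
    |∑ s', (empTrans ω h s a s' - M.p h s a s') * V s'| ≤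
      R * Real.sqrt (alphaKL (Fintype.card S) (Fintype.card A) H δ (count ω h s a) /
        count ω h s a) := by
  set n := count ω h s a with hn'
  have hnR : (0 : ℝ) < n := by exact_mod_cast hn
  have hsupp' : ∀ s', transCount ω h s a s' ≠ 0 → M.p h s a s' ≠ 0 := by
    intro s' hs'
    obtain ⟨i, hi⟩ := Finset.card_ne_zero.mp hs'
    obtain ⟨h1, h2⟩ := (Finset.mem_filter.mp hi).2
    obtain ⟨h3, h4⟩ := Prod.mk.inj h1
    have := hsupp i
    rwa [h3, h4, h2] at this
  have hemp : ∀ s', empTrans ω h s a s' = transCount ω h s a s' / n := fun s' => by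
    rw [empTrans, if_pos hn]
  refine abs_sum_sub_mul_le (M.p_mem h s a) (empTrans_mem_stdSimplex ω h s a) ?_ ?_ hV0 hV hR
  · intro s' hs'
    refine hsupp' s' fun h0 => hs' ?_
    rw [hemp, h0]; simp
  · have hpow : ∀ s', M.p h s a s' ^ transCount ω h s a s' ≠ 0 := by
      intro s'
      by_cases h0 : transCount ω h s a s' = 0
      · rw [h0]; simp
      · exact pow_ne_zero _ (hsupp' s' h0)
    have hprod : (0 : ℝ) < ∏ s', M.p h s a s' ^ transCount ω h s a s' :=
      Finset.prod_pos fun s' _ =>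
        lt_of_le_of_ne (pow_nonneg ((M.p_mem h s a).1 s') _) (hpow s').symm
    have hlog : Real.log (laplaceProb (transCount ω h s a)) -
        ∑ s', (transCount ω h s a s' : ℝ) * Real.log (M.p h s a s') ≤
        Real.log (2 * Fintype.card S * Fintype.card A * H / δ) := by
      have := Real.log_le_log (div_pos (laplaceProb_pos _) hprod) hratio.le
      rw [Real.log_div (laplaceProb_pos _).ne' hprod.ne', Real.log_prod fun s' _ => hpow s'] at this
      simpa only [Real.log_pow] using this
    have hlap := sum_mul_log_empirical_le (transCount ω h s a)
    rw [sum_transCount, ← hn'] at hlap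
    -- `n` times the divergence is the log-likelihood of the empirical kernel minus that of the true
    -- one; the Laplace likelihood is inserted between them through `hlap` and `hlog`.
    have hkl : ∑ s', empTrans ω h s a s' * Real.log (empTrans ω h s a s' / M.p h s a s') =
        (∑ s', (transCount ω h s a s' : ℝ) * Real.log (transCount ω h s a s' / n) -
          ∑ s', (transCount ω h s a s' : ℝ) * Real.log (M.p h s a s')) / n := by
      rw [← Finset.sum_sub_distrib, Finset.sum_div]
      refine Finset.sum_congr rfl fun s' _ => ?_
      rw [hemp]
      by_cases h0 : transCount ω h s a s' = 0
      · rw [h0]; simp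
      · have h0R : (transCount ω h s a s' : ℝ) ≠ 0 := by exact_mod_cast h0
        rw [Real.log_div (div_ne_zero h0R hnR.ne') (hsupp' s' h0)]
        ring
    rw [hkl]
    refine div_le_div_of_nonneg_right ?_ hnR.le
    have := alphaKL_ge (S := Fintype.card S) (A := Fintype.card A) (H := H) (δ := δ) n
    linarith

end TransitionConcentration

/-! ### Comparison of returns with value functions. -/

section Performance

variable {S A : Type*} [Fintype S] [DecidableEq S] [Fintype A] {H : ℕ}

theorem IsEpisodeLaw.sum_mul_init {M : MDP S A H} {q : Episode S A H → ℝ}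
    (hq : IsEpisodeLaw M q) (f : S → ℝ) : ∑ m, q m * f (m.1 0) = f M.init := by
  rw [← one_mul (f M.init), ← hq.sum_one, Finset.sum_mul]
  refine Finset.sum_congr rfl fun m _ => ?_
  by_cases hm : q m = 0
  · rw [hm, zero_mul, zero_mul]
  · rw [hq.init m hm]

/-- The value of the initial state telescopes along an episode. -/
theorem IsEpisodeLaw.value_init {M : MDP S A H} {q : Episode S A H → ℝ}
    (hq : IsEpisodeLaw M q) (V : ℕ → S → ℝ) (hV : ∀ s, V H s = 0) :
    V 0 M.init = ∑ m, q m * ∑ h : Fin H,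
      (V h (m.1 h.castSucc) - ∑ s', M.p h (m.1 h.castSucc) (m.2 h) s' * V (h + 1) s') := by
  let F : Fin (H + 1) → ℝ := fun i => ∑ m, q m * V i (m.1 i)
  have h1 : F 0 + ∑ i : Fin H, F i.succ = ∑ i : Fin H, F i.castSucc + F (Fin.last H) := by
    rw [← Fin.sum_univ_succ, ← Fin.sum_univ_castSucc]
  have hlast : F (Fin.last H) = 0 := by simp [F, hV]
  have h0 : F 0 = V 0 M.init := hq.sum_mul_init (V 0)
  have hs : ∀ i : Fin H, F i.succ = ∑ m, q m *
      ∑ s', M.p i (m.1 i.castSucc) (m.2 i) s' * V (i + 1) s' := fun i =>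
    hq.trans i fun _ _ s' => V (i + 1) s'
  have h2 : ∑ m, q m * ∑ h : Fin H,
      (V h (m.1 h.castSucc) - ∑ s', M.p h (m.1 h.castSucc) (m.2 h) s' * V (h + 1) s') =
      ∑ i : Fin H, (F i.castSucc - F i.succ) := by
    simp_rw [Finset.mul_sum Finset.univ (fun h : Fin H => _ - _)]
    rw [Finset.sum_comm]
    refine Finset.sum_congr rfl fun i _ => ?_
    rw [hs, ← Finset.sum_sub_distrib]
    refine Finset.sum_congr rfl fun m _ => ?_
    rw [← mul_sub]
    rfl
  rw [h2, Finset.sum_sub_distrib]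
  linarith

/-- A function dominating its own Bellman backup dominates every return.
`IsEpisodeLaw.le_sum_reward` is the converse bound, with its condition imposed only along episodes
of positive probability. -/
theorem IsEpisodeLaw.sum_reward_le {M : MDP S A H} {q : Episode S A H → ℝ}
    (hq : IsEpisodeLaw M q) (V : ℕ → S → ℝ) (hV : ∀ s, V H s = 0) (r : Fin H → S → A → ℝ)
    (hr : ∀ (h : Fin H) s a, r h s a + ∑ s', M.p h s a s' * V (h + 1) s' ≤ V h s) :
    ∑ m, q m * ∑ h : Fin H, r h (m.1 h.castSucc) (m.2 h) ≤ V 0 M.init := by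
  rw [hq.value_init V hV]
  refine Finset.sum_le_sum fun m _ => mul_le_mul_of_nonneg_left ?_ (hq.nonneg m)
  exact Finset.sum_le_sum fun h _ => le_sub_iff_add_le.mpr (hr _ _ _)

theorem IsEpisodeLaw.le_sum_reward {M : MDP S A H} {q : Episode S A H → ℝ}
    (hq : IsEpisodeLaw M q) (V : ℕ → S → ℝ) (hV : ∀ s, V H s = 0) (r : Fin H → S → A → ℝ)
    (hr : ∀ m, q m ≠ 0 → ∀ h : Fin H, V h (m.1 h.castSucc) ≤ r h (m.1 h.castSucc) (m.2 h) +
      ∑ s', M.p h (m.1 h.castSucc) (m.2 h) s' * V (h + 1) s') :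
    V 0 M.init ≤ ∑ m, q m * ∑ h : Fin H, r h (m.1 h.castSucc) (m.2 h) := by
  rw [hq.value_init V hV]
  refine Finset.sum_le_sum fun m _ => ?_
  by_cases hm : q m = 0
  · rw [hm, zero_mul, zero_mul]
  · refine mul_le_mul_of_nonneg_left ?_ (hq.nonneg m)
    exact Finset.sum_le_sum fun h _ => sub_le_iff_le_add.mpr (hr m hm h)

end Performance

/-! ### Optimism and the one-step error of greedy planning. -/

section Planning

theorem clip_le_of_le {x : EReal} {hi v : ℝ} (hx : x ≤ v) (hv : 0 ≤ v) : clip x 0 hi ≤ v := by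
  unfold clip
  have h1 : max (min x (hi : EReal)) ((0 : ℝ) : EReal) ≤ (v : EReal) :=
    max_le ((min_le_left _ _).trans hx) (EReal.coe_le_coe_iff.mpr hv)
  have h2 : max (min x (hi : EReal)) ((0 : ℝ) : EReal) ≠ ⊥ :=
    ne_of_gt (lt_of_lt_of_le (EReal.bot_lt_coe 0) (le_max_right _ _))
  have := EReal.toReal_le_toReal h1 h2 (EReal.coe_ne_top v)
  simpa using this

theorem clip_nonneg (x : EReal) (hi : ℝ) : 0 ≤ clip x 0 hi := by
  unfold clip
  exact EReal.toReal_nonneg (by simp)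

theorem clip_le (x : EReal) {hi : ℝ} (h : 0 ≤ hi) : clip x 0 hi ≤ hi := by
  unfold clip
  have h1 : max (min x (hi : EReal)) ((0 : ℝ) : EReal) ≤ (hi : EReal) :=
    max_le (min_le_right _ _) (EReal.coe_le_coe_iff.mpr h)
  have h2 : max (min x (hi : EReal)) ((0 : ℝ) : EReal) ≠ ⊥ :=
    ne_of_gt (lt_of_lt_of_le (EReal.bot_lt_coe 0) (le_max_right _ _))
  have := EReal.toReal_le_toReal h1 h2 (EReal.coe_ne_top hi)
  simpa using this

theorem le_clip {x : EReal} {hi v : ℝ} (hx : (v : EReal) ≤ x) (hv : v ≤ hi) (h : 0 ≤ hi) :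
    v ≤ clip x 0 hi := by
  unfold clip
  have h1 : (v : EReal) ≤ max (min x (hi : EReal)) ((0 : ℝ) : EReal) :=
    le_trans (le_min hx (EReal.coe_le_coe_iff.mpr hv)) (le_max_left _ _)
  have h2 : max (min x (hi : EReal)) ((0 : ℝ) : EReal) ≠ ⊤ :=
    ne_of_lt (lt_of_le_of_lt (max_le (min_le_right _ _) (EReal.coe_le_coe_iff.mpr h))
      (EReal.coe_lt_top hi))
  have := EReal.toReal_le_toReal h1 (EReal.coe_ne_bot v) h2
  simpa using this

variable {S A : Type*} [Fintype S] [DecidableEq S] [Fintype A] [DecidableEq A] {H : ℕ}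

theorem one_le_card_mul_card (s : S) (a : A) :
    (1 : ℝ) ≤ Fintype.card S * Fintype.card A := by
  have h1 : 0 < Fintype.card S := Fintype.card_pos_iff.mpr ⟨s⟩
  have h2 : 0 < Fintype.card A := Fintype.card_pos_iff.mpr ⟨a⟩
  exact_mod_cast Nat.mul_pos h1 h2

/-- The reward that the forecaster's prediction induces. -/
def reward {t : ℕ} (ω : Fin t → Episode S A H) (h : Fin H) (s : S) (a : A) : ℝ :=
  Real.log (1 / forecast 1 ω h s a)

theorem reward_nonneg {t : ℕ} (ω : Fin t → Episode S A H) (h : Fin H) (s : S) (a : A) :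
    0 ≤ reward ω h s a := by
  have h1 := one_le_card_mul_card s a
  have h2 : (count ω h s a : ℝ) ≤ t := by exact_mod_cast count_le ω h s a
  have h3 : (0 : ℝ) ≤ count ω h s a := Nat.cast_nonneg _
  unfold reward forecast
  refine Real.log_nonneg ?_
  rw [mul_one, one_div_div, le_div_iff₀ (by positivity)]
  linarith

theorem reward_le {t : ℕ} (ω : Fin t → Episode S A H) (h : Fin H) (s : S) (a : A) :
    reward ω h s a ≤ Real.log (t + Fintype.card S * Fintype.card A) := by
  have h1 := one_le_card_mul_card s a
  have h3 : (0 : ℝ) ≤ count ω h s a := Nat.cast_nonneg _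
  have h4 : (0 : ℝ) ≤ t := Nat.cast_nonneg _
  unfold reward forecast
  rw [mul_one, one_div_div]
  refine Real.log_le_log (by positivity) (div_le_self (by positivity) (by linarith))

theorem optV_of_ge (δ : ℝ) {t : ℕ} (ω : Fin t → Episode S A H) (s : S) :
    optV 1 δ ω H s = 0 := by
  rw [optV]; simp

theorem optV_of_lt (δ : ℝ) {t : ℕ} (ω : Fin t → Episode S A H) (h : Fin H) (s : S) :
    optV 1 δ ω h s = clip (⨆ a : A, optQ 1 δ ω h s a) 0
      (Real.log (t + Fintype.card S * Fintype.card A) * H) := by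
  rw [optV, dif_pos h.isLt, div_one]
  rfl

variable [Nonempty A]

theorem log_range_nonneg (t : ℕ) (s : S) :
    0 ≤ Real.log (t + Fintype.card S * Fintype.card A) := by
  obtain ⟨a⟩ := ‹Nonempty A›
  have h1 := one_le_card_mul_card s a
  have h4 : (0 : ℝ) ≤ t := Nat.cast_nonneg _
  exact Real.log_nonneg (by linarith)

theorem optV_nonneg (δ : ℝ) {t : ℕ} (ω : Fin t → Episode S A H) (h : ℕ) (s : S) :
    0 ≤ optV 1 δ ω h s := by
  rw [optV]
  split_ifs
  · exact clip_nonneg _ _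
  · exact le_rfl

theorem optV_le (δ : ℝ) {t : ℕ} (ω : Fin t → Episode S A H) (h : ℕ) (s : S) :
    optV 1 δ ω h s ≤ Real.log (t + Fintype.card S * Fintype.card A) * H := by
  have h0 : 0 ≤ Real.log (t + Fintype.card S * Fintype.card A) * H :=
    mul_nonneg (log_range_nonneg t s) (Nat.cast_nonneg _)
  rw [optV]
  split_ifs
  · rw [div_one]; exact clip_le _ h0
  · exact h0

/-- The bonus at a state-action pair that was visited. -/
def realBonus (δ : ℝ) {t : ℕ} (ω : Fin t → Episode S A H) (h : Fin H) (s : S) (a : A) : ℝ :=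
  Real.sqrt (2 * (H : ℝ) ^ 2 * Real.log (t + Fintype.card S * Fintype.card A) ^ 2 *
    alphaKL (Fintype.card S) (Fintype.card A) H δ (count ω h s a) / count ω h s a)

theorem optQ_of_pos (δ : ℝ) {t : ℕ} (ω : Fin t → Episode S A H) (h : Fin H) (s : S) (a : A)
    (hn : count ω h s a ≠ 0) :
    optQ 1 δ ω h s a = ((reward ω h s a + ∑ s' : S, empTrans ω h s a s' *
      optV 1 δ ω (h + 1) s' + realBonus δ ω h s a : ℝ) : EReal) := by
  rw [optQ, planStep, bonus, if_neg hn, ← EReal.coe_add]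
  rfl

theorem optQ_of_zero (δ : ℝ) {t : ℕ} (ω : Fin t → Episode S A H) (h : Fin H) (s : S) (a : A)
    (hn : count ω h s a = 0) : optQ 1 δ ω h s a = ⊤ := by
  rw [optQ, planStep, bonus, if_pos hn, EReal.coe_add_top]

/-- The estimated transitions after the episodes `ω` are accurate at all visited pairs. -/
def AccurateTrans (M : MDP S A H) (δ : ℝ) {t : ℕ} (ω : Fin t → Episode S A H) : Prop :=
  ∀ (h : Fin H) (s : S) (a : A), count ω h s a ≠ 0 → ∀ V : S → ℝ, (∀ s', 0 ≤ V s') →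
    (∀ s', V s' ≤ Real.log (t + Fintype.card S * Fintype.card A) * H) →
    |∑ s', (empTrans ω h s a s' - M.p h s a s') * V s'| ≤ realBonus δ ω h s a

/-- Optimism: at visited pairs the bonus covers the estimation error, and at unvisited pairs it is
infinite. -/
theorem AccurateTrans.sum_reward_le_optV {M : MDP S A H} {δ : ℝ} {t : ℕ}
    {ω : Fin t → Episode S A H} (hω : AccurateTrans M δ ω) {q : Episode S A H → ℝ}
    (hq : IsEpisodeLaw M q) :
    ∑ m, q m * ∑ h : Fin H, reward ω h (m.1 h.castSucc) (m.2 h) ≤ optV 1 δ ω 0 M.init := by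
  set ℓ := Real.log (t + Fintype.card S * Fintype.card A) with hℓ
  have hℓ0 : 0 ≤ ℓ := log_range_nonneg t M.init
  -- Because it is clipped at `H ℓ` at every step, `optV` need not dominate its Bellman backup.
  -- Capping it by the largest possible remaining return keeps the backup below the clipping level.
  let W : ℕ → S → ℝ := fun h s => min (optV 1 δ ω h s) (((H - h : ℕ) : ℝ) * ℓ)
  have hW0 : ∀ h s, 0 ≤ W h s := fun h s => le_min (optV_nonneg δ ω h s) (by positivity)
  refine (hq.sum_reward_le W (fun s => ?_) (reward ω) fun h s a => ?_).trans (min_le_left _ _)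
  · simp only [W, optV_of_ge, Nat.sub_self, Nat.cast_zero, zero_mul, min_self]
  · have hp := M.p_mem h s a
    have hcast : ((H - h : ℕ) : ℝ) = ((H - (h + 1) : ℕ) : ℝ) + 1 := by
      have : H - (h : ℕ) = H - (h + 1) + 1 := by have := h.isLt; omega
      rw [this]; push_cast; ring
    have hH : ((H - h : ℕ) : ℝ) ≤ H := by exact_mod_cast Nat.sub_le _ _
    have hup : reward ω h s a + ∑ s', M.p h s a s' * W (h + 1) s' ≤ ((H - h : ℕ) : ℝ) * ℓ := by
      have h1 : ∑ s', M.p h s a s' * W (h + 1) s' ≤ ((H - (h + 1) : ℕ) : ℝ) * ℓ := by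
        calc ∑ s', M.p h s a s' * W (h + 1) s'
            ≤ ∑ s', M.p h s a s' * (((H - (h + 1) : ℕ) : ℝ) * ℓ) :=
              Finset.sum_le_sum fun s' _ =>
                mul_le_mul_of_nonneg_left (min_le_right _ _) (hp.1 s')
          _ = _ := by rw [← Finset.sum_mul, hp.2, one_mul]
      have h2 := reward_le ω h s a
      rw [hcast]
      linarith
    have hupH : reward ω h s a + ∑ s', M.p h s a s' * W (h + 1) s' ≤ ℓ * H := by
      refine hup.trans ?_
      rw [mul_comm]
      exact mul_le_mul_of_nonneg_left hH hℓ0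
    refine le_min ?_ hup
    rw [optV_of_lt]
    refine le_clip ?_ hupH (by positivity)
    refine le_trans ?_ (le_iSup (fun a => optQ 1 δ ω h s a) a)
    by_cases hn : count ω h s a = 0
    · rw [optQ_of_zero δ ω h s a hn]; exact le_top
    · rw [optQ_of_pos δ ω h s a hn, EReal.coe_le_coe_iff]
      have hWH : ∀ s', W (h + 1) s' ≤ ℓ * H := fun s' =>
        (min_le_left _ _).trans (optV_le δ ω _ s')
      have h1 := (abs_le.mp (hω h s a hn (W (h + 1)) (hW0 _) hWH)).1
      have h2 : ∑ s', (empTrans ω h s a s' - M.p h s a s') * W (h + 1) s' =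
          ∑ s', empTrans ω h s a s' * W (h + 1) s' - ∑ s', M.p h s a s' * W (h + 1) s' := by
        rw [← Finset.sum_sub_distrib]
        exact Finset.sum_congr rfl fun s' _ => by ring
      have h3 : ∑ s', empTrans ω h s a s' * W (h + 1) s' ≤
          ∑ s', empTrans ω h s a s' * optV 1 δ ω (h + 1) s' :=
        Finset.sum_le_sum fun s' _ => mul_le_mul_of_nonneg_left (min_le_left _ _)
          ((empTrans_mem_stdSimplex ω h s a).1 s')
      linarith

/-- A bound for the one-step error of optimistic planning at a pair visited `n` times. -/
def planError (R c : ℝ) (n : ℕ) : ℝ := if n = 0 then R else min R (c / Real.sqrt n)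

theorem AccurateTrans.optV_le_sum_reward {M : MDP S A H} {δ : ℝ} {t : ℕ}
    {ω : Fin t → Episode S A H} (hω : AccurateTrans M δ ω) {π : MarkovPolicy S A H}
    (hπ : ∀ (h : Fin H) (s : S) (a : A), π.prob h s a ≠ 0 →
      ∀ a' : A, optQ 1 δ ω h s a' ≤ optQ 1 δ ω h s a) {R c : ℝ}
    (hR : Real.log (t + Fintype.card S * Fintype.card A) * H ≤ R)
    (hc : ∀ (h : Fin H) (s : S) (a : A), count ω h s a ≠ 0 →
      2 * realBonus δ ω h s a ≤ c / Real.sqrt (count ω h s a)) :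
    optV 1 δ ω 0 M.init ≤ ∑ m, π.law M m * ∑ h : Fin H,
      (reward ω h (m.1 h.castSucc) (m.2 h) +
        planError R c (count ω h (m.1 h.castSucc) (m.2 h))) := by
  refine (π.isEpisodeLaw M).le_sum_reward (optV 1 δ ω) (optV_of_ge δ ω)
    (fun h s a => reward ω h s a + planError R c (count ω h s a)) fun m hm h => ?_
  have hπm : π.prob h (m.1 h.castSucc) (m.2 h) ≠ 0 :=
    Finset.prod_ne_zero_iff.mp (right_ne_zero_of_mul hm) h (Finset.mem_univ h)
  set s := m.1 h.castSucc
  set a := m.2 h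
  have hgreedy := hπ h s a hπm
  have hp := M.p_mem h s a
  have hr := reward_nonneg ω h s a
  have hpV : 0 ≤ ∑ s', M.p h s a s' * optV 1 δ ω (h + 1) s' :=
    Finset.sum_nonneg fun s' _ => mul_nonneg (hp.1 s') (optV_nonneg δ ω _ s')
  have hVR : optV 1 δ ω h s ≤ R := (optV_le δ ω h s).trans hR
  -- The bound `R` holds at every pair, since `optV ≤ R` while rewards and continuation values are
  -- nonnegative.
  unfold planError
  split_ifs with hn
  · linarith
  · rw [← min_add_add_left, ← min_add_add_right]
    refine le_min (by linarith) ?_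
    -- At a visited greedy action the bonus counts twice: once inside `optQ`, once for replacing
    -- empirical by true transitions.
    have hsup : ⨆ a : A, optQ 1 δ ω h s a ≤ optQ 1 δ ω h s a := iSup_le hgreedy
    rw [optQ_of_pos δ ω h s a hn] at hsup
    have h1 := (abs_le.mp (hω h s a hn (optV 1 δ ω (h + 1)) (optV_nonneg δ ω _)
      (optV_le δ ω _))).2
    have h2 : ∑ s', (empTrans ω h s a s' - M.p h s a s') * optV 1 δ ω (h + 1) s' =
        ∑ s', empTrans ω h s a s' * optV 1 δ ω (h + 1) s' -
          ∑ s', M.p h s a s' * optV 1 δ ω (h + 1) s' := by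
      rw [← Finset.sum_sub_distrib]
      exact Finset.sum_congr rfl fun s' _ => by ring
    have h3 := hc h s a hn
    have hb : 0 ≤ realBonus δ ω h s a := Real.sqrt_nonneg _
    have hpE : 0 ≤ ∑ s', empTrans ω h s a s' * optV 1 δ ω (h + 1) s' :=
      Finset.sum_nonneg fun s' _ => mul_nonneg ((empTrans_mem_stdSimplex ω h s a).1 s')
        (optV_nonneg δ ω _ s')
    have h4 : optV 1 δ ω h s ≤ reward ω h s a + ∑ s' : S, empTrans ω h s a s' *
        optV 1 δ ω (h + 1) s' + realBonus δ ω h s a := by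
      rw [optV_of_lt]
      exact clip_le_of_le hsup (by linarith)
    linarith

end Planning

/-! ### Sums along the sampled episodes. -/

section Paths

theorem sum_adapted_snoc {X : Type*} (G : (t : ℕ) → (Fin t → X) → X → ℝ) {T : ℕ}
    (ω : Fin T → X) (x : X) :
    ∑ t : Fin (T + 1), G t (fun i => (Fin.snoc (α := fun _ => X) ω x : Fin (T + 1) → X)
        (i.castLE t.isLt.le)) ((Fin.snoc (α := fun _ => X) ω x : Fin (T + 1) → X) t) =
      ∑ t : Fin T, G t (fun i => ω (i.castLE t.isLt.le)) (ω t) + G T ω x := by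
  rw [Fin.sum_univ_castSucc]
  congr 1
  · refine Finset.sum_congr rfl fun i _ => ?_
    rw [Fin.snoc_castSucc]
    congr 1
    exact snoc_castLE ω x i.isLt.le _
  · rw [Fin.snoc_last]
    congr 1
    exact snoc_castLE ω x le_rfl _

variable {S A : Type*} [Fintype S] [DecidableEq S] [Fintype A] [DecidableEq A] {H : ℕ}

/-- The forecaster is the Laplace rule on pairs, so its predictions multiply to the Laplace
probability of the sequence of visited pairs. -/
theorem sum_path_reward {T : ℕ} (ω : Fin T → Episode S A H) (h : Fin H) :
    ∑ t : Fin T, reward (fun i : Fin t => ω (i.castLE t.isLt.le)) h ((ω t).1 h.castSucc)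
      ((ω t).2 h) = - Real.log (laplaceProb fun x : S × A => count ω h x.1 x.2) := by
  induction T with
  | zero =>
    have : (fun x : S × A => count ω h x.1 x.2) = fun _ => 0 := by
      funext x; simp [count]
    rw [this, laplaceProb_zero]; simp
  | succ T ih =>
    obtain ⟨ω, m, rfl⟩ : ∃ (ω' : Fin T → Episode S A H) (m : Episode S A H),
      ω = Fin.snoc (α := fun _ => Episode S A H) ω' m :=
      ⟨Fin.init ω, ω (Fin.last T), (Fin.snoc_init_self (α := fun _ => Episode S A H) ω).symm⟩
    rw [sum_adapted_snoc (fun t ω m => reward ω h (m.1 h.castSucc) (m.2 h)), ih]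
    have h1 : (fun x : S × A => count (Fin.snoc (α := fun _ => Episode S A H) ω m :
        Fin (T + 1) → Episode S A H) h x.1 x.2) =
        fun x => count ω h x.1 x.2 + if x = m.pair h then 1 else 0 := by
      funext x
      rw [count_snoc]
      simp only [eq_comm, Prod.mk.eta]
    rw [h1, laplaceProb_add_single (fun x : S × A => count ω h x.1 x.2), sum_count]
    have hpos : (0 : ℝ) < (count ω h (m.pair h).1 (m.pair h).2 + 1) /
        (T + Fintype.card (S × A)) := by
      have : (0 : ℝ) < Fintype.card (S × A) := by
        exact_mod_cast Fintype.card_pos_iff.mpr ⟨m.pair h⟩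
      positivity
    rw [Real.log_mul (laplaceProb_pos _).ne' hpos.ne', neg_add]
    congr 1
    rw [reward, forecast, one_div, Real.log_inv, Fintype.card_prod]
    push_cast
    simp only [mul_one]
    rfl

/-- Potential argument: at step `h` each episode raises one count only, and the potential of that
pair grows by at least the cost incurred. -/
theorem sum_path_count_le {φ Φ : ℕ → ℝ} (h0 : 0 ≤ Φ 0) (hstep : ∀ n, φ n + Φ n ≤ Φ (n + 1))
    {T : ℕ} (ω : Fin T → Episode S A H) (h : Fin H) :
    ∑ t : Fin T, φ (count (fun i : Fin t => ω (i.castLE t.isLt.le)) h ((ω t).1 h.castSucc)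
      ((ω t).2 h)) ≤ ∑ x : S × A, Φ (count ω h x.1 x.2) := by
  induction T with
  | zero =>
    simp only [Finset.univ_eq_empty, Finset.sum_empty]
    refine Finset.sum_nonneg fun x _ => ?_
    have : count ω h x.1 x.2 = 0 := by simp [count]
    rw [this]; exact h0
  | succ T ih =>
    obtain ⟨ω, m, rfl⟩ : ∃ (ω' : Fin T → Episode S A H) (m : Episode S A H),
      ω = Fin.snoc (α := fun _ => Episode S A H) ω' m :=
      ⟨Fin.init ω, ω (Fin.last T), (Fin.snoc_init_self (α := fun _ => Episode S A H) ω).symm⟩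
    rw [sum_adapted_snoc (fun t ω m => φ (count ω h (m.1 h.castSucc) (m.2 h)))]
    have h1 : ∀ x : S × A, Φ (count ω h x.1 x.2) + (if m.pair h = x then
        φ (count ω h x.1 x.2) else 0) ≤ Φ (count (Fin.snoc (α := fun _ => Episode S A H) ω m :
        Fin (T + 1) → Episode S A H) h x.1 x.2) := by
      intro x
      rw [count_snoc]
      simp only [Prod.mk.eta]
      split_ifs
      · linarith [hstep (count ω h x.1 x.2)]
      · simp
    refine le_trans (add_le_add_left (ih ω) _) ?_
    refine le_trans (le_of_eq ?_) (Finset.sum_le_sum fun x _ => h1 x)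
    rw [Finset.sum_add_distrib]
    simp only [Finset.sum_ite_eq, Finset.mem_univ, if_true]
    rfl

/-- The potential pays `R` at the first visit, and afterwards compares `1 / √n` with the increment
of `√n`. -/
theorem planError_add_le {R c : ℝ} (hc : 0 ≤ c) (n : ℕ) :
    planError R c n + ((if n = 0 then 0 else R) + 5 / 2 * c * Real.sqrt n) ≤
      (if n + 1 = 0 then 0 else R) + 5 / 2 * c * Real.sqrt (n + 1 : ℕ) := by
  unfold planError
  rw [if_neg (Nat.succ_ne_zero n)]
  split_ifs with hn
  · subst hn; simp; linarith
  · have hn1 : (1 : ℝ) ≤ n := by exact_mod_cast Nat.one_le_iff_ne_zero.mpr hn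
    set x := Real.sqrt n with hx
    set y := Real.sqrt (n + 1 : ℕ) with hy
    have hx2 : x ^ 2 = n := Real.sq_sqrt (by linarith)
    have hy2 : y ^ 2 = n + 1 := by
      rw [hy, Real.sq_sqrt (by positivity)]; push_cast; ring
    have hx0 : 0 < x := Real.sqrt_pos.mpr (by linarith)
    have hy0 : 0 ≤ y := Real.sqrt_nonneg _
    -- Valid because `n ≥ 1`. It gives `y + x ≤ 5 / 2 * x`, the source of the constant `5 / 2`.
    have hyx : y ≤ 3 / 2 * x := by
      refine abs_le_of_sq_le_sq' ?_ (by positivity) |>.2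
      nlinarith
    have h1 : 1 / x ≤ 5 / 2 * (y - x) := by
      rw [div_le_iff₀ hx0]
      have h2 : (y - x) * (y + x) = 1 := by ring_nf; linarith
      have h3 : 0 ≤ y - x := by
        by_contra hneg
        push Not at hneg
        nlinarith
      nlinarith
    have h4 : c / x ≤ c * (5 / 2 * (y - x)) := by
      rw [div_eq_mul_one_div]
      exact mul_le_mul_of_nonneg_left h1 hc
    have h5 := min_le_right R (c / x)
    linarith

theorem sum_sqrt_le {ι : Type*} [Fintype ι] (N : ι → ℝ) (hN : ∀ i, 0 ≤ N i) :
    ∑ i, Real.sqrt (N i) ≤ Real.sqrt (Fintype.card ι * ∑ i, N i) := by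
  refine Real.le_sqrt_of_sq_le ?_
  have := sq_sum_le_card_mul_sum_sq (s := Finset.univ) (f := fun i => Real.sqrt (N i))
  simpa only [Real.sq_sqrt (hN _), Finset.card_univ] using this

theorem sum_path_planError_le {R c : ℝ} (hR : 0 ≤ R) (hc : 0 ≤ c) {T : ℕ}
    (ω : Fin T → Episode S A H) (h : Fin H) :
    ∑ t : Fin T, planError R c (count (fun i : Fin t => ω (i.castLE t.isLt.le)) h
      ((ω t).1 h.castSucc) ((ω t).2 h)) ≤
      Fintype.card (S × A) * R + 5 / 2 * c * Real.sqrt (Fintype.card (S × A) * T) := by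
  refine (sum_path_count_le (Φ := fun n => (if n = 0 then 0 else R) + 5 / 2 * c * Real.sqrt n)
    (by simp) (planError_add_le hc) ω h).trans ?_
  rw [Finset.sum_add_distrib, ← Finset.mul_sum]
  refine add_le_add ?_ (mul_le_mul_of_nonneg_left ?_ (by positivity))
  · refine (Finset.sum_le_sum (g := fun _ => R) fun x _ => ?_).trans ?_
    · split_ifs; exacts [hR, le_rfl]
    · simp
  · refine (sum_sqrt_le _ fun _ => Nat.cast_nonneg _).trans ?_
    rw [← Nat.cast_sum, sum_count]

/-- The forecaster's regret against the mixture: from Laplace log-loss to empirical entropy, to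
cross-entropy of the counts against a smoothed `D`, to cross-entropy of `D`, and finally to the
entropy of `D / T`. -/
theorem sum_path_reward_le {T : ℕ} (hT : 0 < T) (ω : Fin T → Episode S A H) (h : Fin H)
    {D : S × A → ℝ} (hD : ∀ x, 0 ≤ D x) (hDT : ∑ x, D x = T) {lam β : ℝ}
    (hND : ∀ x, |(count ω h x.1 x.2 : ℝ) - D x| ≤ lam * D x + β / lam) :
    ∑ t : Fin T, reward (fun i : Fin t => ω (i.castLE t.isLt.le)) h ((ω t).1 h.castSucc)
      ((ω t).2 h) ≤ T * ∑ x, Real.negMulLog (D x / T) + Fintype.card (S × A) +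
        Real.log (T + Fintype.card (S × A)) * (lam * T + Fintype.card (S × A) * (β / lam)) +
        Fintype.card (S × A) * Real.log (T + 1) := by
  have hTR : (0 : ℝ) < T := by exact_mod_cast hT
  set k : ℝ := (Fintype.card (S × A) : ℝ) with hk
  have hk0 : 0 ≤ k := Nat.cast_nonneg _
  have hlap := sum_mul_log_empirical_le fun x : S × A => count ω h x.1 x.2
  rw [sum_count] at hlap
  have hcard : ((Fintype.card (S × A) - 1 : ℕ) : ℝ) * Real.log (T + 1) ≤
      k * Real.log (T + 1) := by
    refine mul_le_mul_of_nonneg_right ?_ (Real.log_nonneg (by linarith))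
    rw [hk]
    exact_mod_cast Nat.sub_le _ _
  have hw0 : ∀ x, 0 ≤ Real.log ((T + k) / (D x + 1)) ∧
      Real.log ((T + k) / (D x + 1)) ≤ Real.log (T + k) := by
    intro x
    have hDx : D x ≤ T := hDT ▸ Finset.single_le_sum (fun x _ => hD x) (Finset.mem_univ x)
    have hk1 : 1 ≤ k := by
      rw [hk]; exact_mod_cast Nat.one_le_iff_ne_zero.mpr (Fintype.card_pos_iff.mpr ⟨x⟩).ne'
    have := hD x
    exact ⟨Real.log_nonneg (by rw [le_div_iff₀ (by linarith)]; linarith),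
      Real.log_le_log (by positivity) (div_le_self (by positivity) (by linarith))⟩
  -- Smoothing `D` by one keeps the logarithms between 0 and `log (T + k)`, so the deviation `N - D`
  -- enters linearly.
  have hgibbs : -∑ x : S × A, (count ω h x.1 x.2 : ℝ) * Real.log (count ω h x.1 x.2 / T) ≤
      ∑ x : S × A, (count ω h x.1 x.2 : ℝ) * Real.log ((T + k) / (D x + 1)) := by
    have hpos : ∀ x, 0 < (D x + 1) / (T + k) := fun x => by
      have := hD x
      positivity
    have hq : ∑ x, (D x + 1) / (T + k) = 1 := by
      rw [← Finset.sum_div, Finset.sum_add_distrib, hDT]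
      simp only [Finset.sum_const, Finset.card_univ, nsmul_eq_mul, mul_one]
      exact div_self (by positivity)
    have hd : ∑ x : S × A, (count ω h x.1 x.2 : ℝ) / T = 1 := by
      rw [← Finset.sum_div, ← Nat.cast_sum, sum_count, div_self hTR.ne']
    have := sum_negMulLog_le (d := fun x : S × A => (count ω h x.1 x.2 : ℝ) / T)
      (q := fun x => (D x + 1) / (T + k)) (fun x => by positivity) hpos (by rw [hq, hd])
    have := mul_le_mul_of_nonneg_left this hTR.le
    rw [Finset.mul_sum, Finset.mul_sum] at this
    rw [← Finset.sum_neg_distrib]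
    refine le_trans (le_of_eq ?_) (this.trans (le_of_eq ?_))
    · refine Finset.sum_congr rfl fun x _ => ?_
      rw [Real.negMulLog]; field_simp
    · refine Finset.sum_congr rfl fun x _ => ?_
      rw [one_div_div]; field_simp
  have hdiff : ∑ x : S × A, (count ω h x.1 x.2 : ℝ) * Real.log ((T + k) / (D x + 1)) ≤
      ∑ x, D x * Real.log ((T + k) / (D x + 1)) +
        Real.log (T + k) * (lam * T + k * (β / lam)) := by
    -- The deviation is proportional to `D x` up to a constant, so summing over pairs costs `lam *
    -- T` instead of `k * lam * T`.
    have : ∀ x : S × A, (count ω h x.1 x.2 : ℝ) * Real.log ((T + k) / (D x + 1)) ≤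
        D x * Real.log ((T + k) / (D x + 1)) + Real.log (T + k) * (lam * D x + β / lam) := by
      intro x
      have h2 := mul_le_mul_of_nonneg_right
        (le_abs_self ((count ω h x.1 x.2 : ℝ) - D x)) (hw0 x).1
      have h3 := mul_le_mul (hND x) (hw0 x).2 (hw0 x).1 ((abs_nonneg _).trans (hND x))
      linarith
    refine (Finset.sum_le_sum fun x _ => this x).trans (le_of_eq ?_)
    rw [Finset.sum_add_distrib, ← Finset.mul_sum, Finset.sum_add_distrib, ← Finset.mul_sum, hDT]
    simp [hk]
  have hsm := sum_mul_log_smoothed_le hTR hD hDT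
  rw [sum_path_reward]
  linarith

end Paths

/-! ### The entropy gap from the two regrets. -/

section Assembly

variable {S A : Type*} [Fintype S] [DecidableEq S] [Fintype A] [DecidableEq A] {H : ℕ}

theorem visitation_mixtureLaw (M : MDP S A H) (pol : SamplingRule S A H) {T : ℕ}
    (ω : Fin T → Episode S A H) (h : Fin H) (x : S × A) :
    visitation (mixtureLaw M pol ω) h x =
      (∑ t : Fin T, visitation ((pol.at ω t).law M) h x) / T := by
  simp only [visitation, mixtureLaw]
  rw [Finset.sum_comm, Finset.sum_div]
  refine Finset.sum_congr rfl fun m _ => ?_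
  split_ifs
  · ring
  · simp

theorem sum_forecast {t : ℕ} (ω : Fin t → Episode S A H) (h : Fin H) [Nonempty (S × A)] :
    ∑ x : S × A, forecast 1 ω h x.1 x.2 = 1 := by
  unfold forecast
  have hk : (0 : ℝ) < Fintype.card (S × A) := by exact_mod_cast Fintype.card_pos
  rw [← Finset.sum_div, Finset.sum_add_distrib, ← Nat.cast_sum, sum_count]
  simp only [Finset.sum_const, Finset.card_univ, nsmul_eq_mul, mul_one]
  rw [Fintype.card_prod] at hk ⊢
  push_cast at hk ⊢
  exact div_self (by positivity)

theorem visitationEntropy_le_sum_reward {M : MDP S A H} {q : Episode S A H → ℝ}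
    (hq : IsEpisodeLaw M q) [Nonempty A] {t : ℕ} (ω : Fin t → Episode S A H) :
    visitationEntropy (visitation q) ≤
      ∑ m, q m * ∑ h : Fin H, reward ω h (m.1 h.castSucc) (m.2 h) := by
  have : Nonempty S := ⟨M.init⟩
  have h1 : ∑ m, q m * ∑ h : Fin H, reward ω h (m.1 h.castSucc) (m.2 h) =
      ∑ h : Fin H, ∑ x : S × A, visitation q h x * reward ω h x.1 x.2 := by
    simp_rw [Finset.mul_sum]
    rw [Finset.sum_comm]
    refine Finset.sum_congr rfl fun h _ => ?_
    rw [sum_visitation_mul q h fun x => reward ω h x.1 x.2]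
    rfl
  rw [h1]
  refine Finset.sum_le_sum fun h _ => ?_
  refine sum_negMulLog_le (q := fun x : S × A => forecast 1 ω h x.1 x.2)
    (visitation_nonneg hq h) (fun x => ?_) (by rw [sum_forecast, sum_visitation hq])
  have := one_le_card_mul_card x.1 x.2
  unfold forecast
  rw [mul_one]
  positivity

/-- The regret of the sampler and of the forecaster bound the entropy gap of the mixture. -/
theorem entropy_gap_le {M : MDP S A H} [Nonempty A] {δ : ℝ} {pol : SamplingRule S A H}
    (hpol : IsEntGame 1 δ pol) {T : ℕ} (hT : 0 < T) (ω : Fin T → Episode S A H)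
    {q : Episode S A H → ℝ} (hq : IsEpisodeLaw M q) {R c lam β μ : ℝ} (hR0 : 0 ≤ R) (hc0 : 0 ≤ c)
    (hacc : ∀ t : Fin T, AccurateTrans M δ (fun i : Fin t => ω (i.castLE t.isLt.le)))
    (hR : ∀ t : Fin T, Real.log ((t : ℕ) + Fintype.card S * Fintype.card A) * H ≤ R)
    (hc : ∀ (t : Fin T) (h : Fin H) (s : S) (a : A),
      count (fun i : Fin t => ω (i.castLE t.isLt.le)) h s a ≠ 0 →
      2 * realBonus δ (fun i : Fin t => ω (i.castLE t.isLt.le)) h s a ≤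
        c / Real.sqrt (count (fun i : Fin t => ω (i.castLE t.isLt.le)) h s a))
    (hcount : ∀ (h : Fin H) (x : S × A),
      |(count ω h x.1 x.2 : ℝ) - ∑ t : Fin T, visitation ((pol.at ω t).law M) h x| ≤
        lam * (∑ t : Fin T, visitation ((pol.at ω t).law M) h x) + β / lam)
    (hmart : ∑ t : Fin T, ∑ m, (pol.at ω t).law M m * ∑ h : Fin H,
        (reward (fun i : Fin t => ω (i.castLE t.isLt.le)) h (m.1 h.castSucc) (m.2 h) +
        planError R c (count (fun i : Fin t => ω (i.castLE t.isLt.le)) h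
          (m.1 h.castSucc) (m.2 h))) ≤
      ∑ t : Fin T, ∑ h : Fin H,
        (reward (fun i : Fin t => ω (i.castLE t.isLt.le)) h ((ω t).1 h.castSucc) ((ω t).2 h) +
        planError R c (count (fun i : Fin t => ω (i.castLE t.isLt.le)) h
          ((ω t).1 h.castSucc) ((ω t).2 h))) + μ) :
    T * (visitationEntropy (visitation q) -
        visitationEntropy (visitation (mixtureLaw M pol ω))) ≤
      μ + H * (Fintype.card (S × A) * R + 5 / 2 * c * Real.sqrt (Fintype.card (S × A) * T) +
        Fintype.card (S × A) + Real.log (T + Fintype.card (S × A)) *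
          (lam * T + Fintype.card (S × A) * (β / lam)) +
        Fintype.card (S × A) * Real.log (T + 1)) := by
  set k : ℝ := (Fintype.card (S × A) : ℝ) with hk
  have hlaw : ∀ t : Fin T, IsEpisodeLaw M ((pol.at ω t).law M) := fun t =>
    (pol.at ω t).isEpisodeLaw M
  have h1 : T * visitationEntropy (visitation q) ≤ ∑ t : Fin T, ∑ m, (pol.at ω t).law M m *
      ∑ h : Fin H, (reward (fun i : Fin t => ω (i.castLE t.isLt.le)) h (m.1 h.castSucc) (m.2 h) +
        planError R c (count (fun i : Fin t => ω (i.castLE t.isLt.le)) h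
          (m.1 h.castSucc) (m.2 h))) := by
    have : ∑ t : Fin T, visitationEntropy (visitation q) =
        T * visitationEntropy (visitation q) := by simp
    rw [← this]
    refine Finset.sum_le_sum fun t _ => ?_
    -- Entropy is bounded by the return for the current forecast, then by the optimistic value, then
    -- by the return of the greedy policy with planning errors.
    refine (visitationEntropy_le_sum_reward hq
      (fun i : Fin t => ω (i.castLE t.isLt.le))).trans ?_
    refine ((hacc t).sum_reward_le_optV hq).trans ?_
    exact (hacc t).optV_le_sum_reward (hpol t _) (hR t) (hc t)
  have h2 : ∀ h : Fin H, ∑ t : Fin T,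
      (reward (fun i : Fin t => ω (i.castLE t.isLt.le)) h ((ω t).1 h.castSucc) ((ω t).2 h) +
        planError R c (count (fun i : Fin t => ω (i.castLE t.isLt.le)) h
          ((ω t).1 h.castSucc) ((ω t).2 h))) ≤
      T * ∑ x, Real.negMulLog (visitation (mixtureLaw M pol ω) h x) +
      (k * R + 5 / 2 * c * Real.sqrt (k * T) + k + Real.log (T + k) *
          (lam * T + k * (β / lam)) + k * Real.log (T + 1)) := by
    intro h
    rw [Finset.sum_add_distrib]
    have h3 := sum_path_planError_le hR0 hc0 ω h
    have h4 := sum_path_reward_le hT ω h (D := fun x => ∑ t : Fin T,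
      visitation ((pol.at ω t).law M) h x)
      (fun x => Finset.sum_nonneg fun t _ => visitation_nonneg (hlaw t) h x)
      (by
        rw [Finset.sum_comm]
        simp only [sum_visitation (hlaw _) h]
        simp) (hcount h)
    simp only [visitation_mixtureLaw]
    linarith
  have h5 := Finset.sum_le_sum fun h (_ : h ∈ (Finset.univ : Finset (Fin H))) => h2 h
  rw [Finset.sum_add_distrib, ← Finset.mul_sum, Finset.sum_comm] at h5
  have h6 : ∑ h : Fin H, (k * R + 5 / 2 * c * Real.sqrt (k * T) + k + Real.log (T + k) *
      (lam * T + k * (β / lam)) + k * Real.log (T + 1)) =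
      H * (k * R + 5 / 2 * c * Real.sqrt (k * T) + k + Real.log (T + k) *
      (lam * T + k * (β / lam)) + k * Real.log (T + 1)) := by
    rw [Finset.sum_const, Finset.card_univ, Fintype.card_fin, nsmul_eq_mul]
  rw [h6] at h5
  have h7 : visitationEntropy (visitation (mixtureLaw M pol ω)) =
      ∑ h : Fin H, ∑ x, Real.negMulLog (visitation (mixtureLaw M pol ω) h x) := rfl
  rw [mul_sub, h7]
  linarith

end Assembly

/-! ### Numerical consequences of the choice of the number of episodes. -/

section Numerics

theorem log_four_mul_ge_one {x : ℝ} (hx : 1 ≤ x) : 1 ≤ Real.log (4 * x) := by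
  rw [Real.le_log_iff_exp_le (by linarith)]
  have := Real.exp_one_lt_d9
  linarith

theorem one_le_confidence {S A H : ℕ} {δ : ℝ} (hS : 0 < S) (hA : 0 < A) (hH : 0 < H)
    (hδ : 0 < δ) (hδ1 : δ < 1) : 1 ≤ (S : ℝ) * A * H / δ := by
  have h1 : (1 : ℝ) ≤ S * A * H := by exact_mod_cast Nat.mul_pos (Nat.mul_pos hS hA) hH
  rw [le_div_iff₀ hδ]
  linarith

theorem log_confidence_ge_one {S A H : ℕ} {δ : ℝ} (hS : 0 < S) (hA : 0 < A) (hH : 0 < H)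
    (hδ : 0 < δ) (hδ1 : δ < 1) : 1 ≤ Real.log (4 * S * A * H / δ) := by
  have := log_four_mul_ge_one (one_le_confidence hS hA hH hδ hδ1)
  rwa [show 4 * ((S : ℝ) * A * H / δ) = 4 * S * A * H / δ by ring] at this

-- The bound `B` contains its own logarithmic factor. With `L = 9 log y`, every factor `L` in `B` is
-- at most a multiple of `y`, so `B + S A ≤ y ^ 9` and the recursion closes.
set_option maxHeartbeats 1000000 in
theorem episodeBound_add_le {S A H : ℕ} {ε δ : ℝ} (hS : 0 < S) (hA : 0 < A) (hH : 0 < H)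
    (hδ : 0 < δ) (hδ1 : δ < 1) (hε : 0 < ε) (hk : 2 ≤ S * A)
    (hεH : ε < H * Real.log (S * A)) :
    9 ≤ logFactor S A H ε δ ∧ Real.log (S * A) ≤ logFactor S A H ε δ ∧
      Real.log (episodeBound S A H ε δ + S * A) ≤ logFactor S A H ε δ := by
  have hS1 : (1 : ℝ) ≤ S := by exact_mod_cast hS
  have hA1 : (1 : ℝ) ≤ A := by exact_mod_cast hA
  have hH1 : (1 : ℝ) ≤ H := by exact_mod_cast hH
  have hg := log_confidence_ge_one hS hA hH hδ hδ1
  set g := Real.log (4 * S * A * H / δ) with hgdef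
  have hkR : (2 : ℝ) ≤ S * A := by exact_mod_cast hk
  set k : ℝ := (S : ℝ) * A with hkdef
  have hk0 : 0 ≤ k := by linarith
  have hSk : (S : ℝ) ≤ k := le_mul_of_one_le_right (by linarith) hA1
  set Z : ℝ := (H : ℝ) ^ 4 * (S : ℝ) ^ (8 / 3 : ℝ) * (A : ℝ) ^ (8 / 3 : ℝ) * g with hZ
  have hZ' : Z = (H : ℝ) ^ 4 * k ^ (8 / 3 : ℝ) * g := by
    rw [hZ, hkdef, Real.mul_rpow (by linarith) (by linarith)]; ring
  have hk43 : k ^ (8 / 3 : ℝ) = (k ^ (4 / 3 : ℝ)) ^ 2 := by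
    rw [← Real.rpow_natCast, ← Real.rpow_mul hk0]; norm_num
  have hk43' : k ^ (4 / 3 : ℝ) = k * k ^ (1 / 3 : ℝ) := by
    rw [show (4 / 3 : ℝ) = 1 + 1 / 3 by norm_num, Real.rpow_add (by linarith), Real.rpow_one]
  -- The exponent `8 / 3` leaves a factor `c ^ 2` beyond `k ^ 2` in `Z`. Since `log k ≤ 3 c`, it
  -- absorbs `ε < H log k` and makes `y` at least `300 H k`.
  set c := k ^ (1 / 3 : ℝ) with hc
  have hc1 : 1 ≤ c := Real.one_le_rpow (by linarith) (by norm_num)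
  have hZ2 : Z = (H : ℝ) ^ 4 * k ^ 2 * c ^ 2 * g := by rw [hZ', hk43, hk43']; ring
  have hlogk : Real.log k ≤ 3 * c := by
    have := Real.log_le_rpow_div hk0 (show (0 : ℝ) < 1 / 3 by norm_num)
    rw [← hc] at this
    linarith
  have hZpos : 0 < Z := by rw [hZ2]; positivity
  have hWge : (H : ℝ) ^ 2 * k * c ≤ Real.sqrt Z := by
    refine Real.le_sqrt_of_sq_le ?_
    rw [hZ2]
    have : 0 ≤ (H : ℝ) ^ 4 * k ^ 2 * c ^ 2 := by positivity
    calc ((H : ℝ) ^ 2 * k * c) ^ 2 = (H : ℝ) ^ 4 * k ^ 2 * c ^ 2 := by ring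
      _ ≤ _ := le_mul_of_one_le_right this hg
  set y := 1010 * Real.sqrt Z / ε with hy
  have hyε : y * ε = 1010 * Real.sqrt Z := by rw [hy]; field_simp
  have hL : logFactor S A H ε δ = 9 * Real.log y := rfl
  have hε3 : ε ≤ H * (3 * c) :=
    hεH.le.trans (mul_le_mul_of_nonneg_left hlogk (by linarith))
  have hyHk : 300 * (H * k) ≤ y := by
    rw [hy, le_div_iff₀ hε]
    have h1 : 300 * (H * k) * ε ≤ 300 * (H * k) * (H * (3 * c)) :=
      mul_le_mul_of_nonneg_left hε3 (by positivity)
    have h2 : 0 ≤ (H : ℝ) ^ 2 * k * c := by positivity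
    linarith
  have hHk : k ≤ H * k := le_mul_of_one_le_left hk0 hH1
  have hy600 : 600 ≤ y := by linarith
  have hy0 : 0 < y := by linarith
  have hlogy1 : 1 ≤ Real.log y := by
    rw [Real.le_log_iff_exp_le hy0]
    have := Real.exp_one_lt_d9
    linarith
  have hlogy := Real.log_le_sub_one_of_pos hy0
  have hky : Real.log k ≤ Real.log y := Real.log_le_log (by linarith) (by linarith)
  have hlogk0 : 0 ≤ Real.log k := Real.log_nonneg (by linarith)
  rw [episodeBound, hL, ← hgdef, ← hkdef]
  refine ⟨by linarith, by linarith, ?_⟩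
  set L := 9 * Real.log y with hLdef
  have hL0 : 0 ≤ L := by linarith
  have hL2 : L + 2 ≤ 9 * y := by linarith
  have hmain : 648 * (Real.log k + L) * (H : ℝ) ^ 4 * S * A * (g + S * (1 + L)) * L / ε ^ 2 ≤
      y ^ 5 := by
    have h1 : (H : ℝ) ^ 4 * k * (g + S * (1 + L)) ≤ Z * (2 + L) := by
      have h2 : g + S * (1 + L) ≤ k * g * (2 + L) := by
        have h3 : g ≤ k * g := le_mul_of_one_le_left (by linarith) (by linarith)
        have h4 : (S : ℝ) * (1 + L) ≤ k * g * (1 + L) := by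
          refine mul_le_mul_of_nonneg_right ?_ (by linarith)
          exact hSk.trans (le_mul_of_one_le_right hk0 hg)
        linarith
      calc (H : ℝ) ^ 4 * k * (g + S * (1 + L)) ≤ (H : ℝ) ^ 4 * k * (k * g * (2 + L)) :=
            mul_le_mul_of_nonneg_left h2 (by positivity)
        _ = ((H : ℝ) ^ 4 * k ^ 2 * g * (2 + L)) * 1 := by ring
        _ ≤ ((H : ℝ) ^ 4 * k ^ 2 * g * (2 + L)) * c ^ 2 :=
            mul_le_mul_of_nonneg_left (one_le_pow₀ hc1) (by positivity)
        _ = Z * (2 + L) := by rw [hZ2]; ring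
    have hZy : 1020100 * Z = y ^ 2 * ε ^ 2 := by
      rw [← mul_pow, hyε, mul_pow, Real.sq_sqrt hZpos.le]; norm_num
    rw [div_le_iff₀ (by positivity)]
    calc 648 * (Real.log k + L) * (H : ℝ) ^ 4 * S * A * (g + S * (1 + L)) * L
        = 648 * ((Real.log k + L) * L) * ((H : ℝ) ^ 4 * k * (g + S * (1 + L))) := by
          rw [hkdef]; ring
      _ ≤ 648 * ((10 * y) * (9 * y)) * (Z * (9 * y)) := by
          refine mul_le_mul ?_ (h1.trans ?_) (by positivity) (by positivity)
          · refine mul_le_mul_of_nonneg_left ?_ (by norm_num)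
            exact mul_le_mul (by linarith) (by linarith) hL0 (by linarith)
          · exact mul_le_mul_of_nonneg_left (by linarith) hZpos.le
      _ = (524880 / 1020100) * y ^ 3 * (1020100 * Z) := by ring
      _ = (524880 / 1020100) * (y ^ 5 * ε ^ 2) := by rw [hZy]; ring
      _ ≤ y ^ 5 * ε ^ 2 := by
          have : 0 ≤ y ^ 5 * ε ^ 2 := by positivity
          linarith
  have hlast : 2 * (H : ℝ) * S * A * (2 + L) / ε ≤ y ^ 2 := by
    rw [div_le_iff₀ hε]
    have h1 : 1010 * ((H : ℝ) * k) ≤ y * ε := by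
      rw [hyε]
      refine mul_le_mul_of_nonneg_left (le_trans ?_ hWge) (by norm_num)
      have h2 : 0 ≤ (H : ℝ) * k := by positivity
      calc (H : ℝ) * k ≤ (H * k) * (H * c) := le_mul_of_one_le_right h2 (one_le_mul_of_one_le_of_one_le hH1 hc1)
        _ = _ := by ring
    calc 2 * (H : ℝ) * S * A * (2 + L) = 2 * ((H : ℝ) * k) * (L + 2) := by rw [hkdef]; ring
      _ ≤ 2 * (y * ε / 1010) * (9 * y) :=
          mul_le_mul (by linarith) hL2 (by linarith) (by positivity)
      _ = (18 / 1010) * (y ^ 2 * ε) := by ring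
      _ ≤ y ^ 2 * ε := by
          have : 0 ≤ y ^ 2 * ε := by positivity
          linarith
  have hsum : 1 + 648 * (Real.log k + L) * (H : ℝ) ^ 4 * S * A * (g + S * (1 + L)) * L / ε ^ 2 +
      2 * (H : ℝ) * S * A * (2 + L) / ε + k ≤ y ^ 9 := by
    have h1 : y ≤ y ^ 5 := le_self_pow₀ (by linarith) (by norm_num)
    have h2 : y ^ 2 ≤ y ^ 5 := pow_le_pow_right₀ (by linarith) (by norm_num)
    have h3 : y ^ 9 = y ^ 5 * y ^ 4 := by ring
    have h4 : y ≤ y ^ 4 := le_self_pow₀ (by linarith) (by norm_num)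
    have h5 : 0 ≤ y ^ 5 := by positivity
    have h6 : y ^ 5 * 4 ≤ y ^ 5 * y ^ 4 := mul_le_mul_of_nonneg_left (by linarith) h5
    linarith
  calc _ ≤ Real.log (y ^ 9) := Real.log_le_log (by positivity) hsum
    _ = L := by rw [Real.log_pow, hLdef]; norm_num

set_option maxHeartbeats 1000000 in
/-- The main numerical consequence of the choice of the number of episodes. -/
theorem regret_le_of_episodeBound_le {S A H T : ℕ} {ε δ : ℝ} (hS : 0 < S) (hA : 0 < A)
    (hH : 0 < H) (hδ : 0 < δ) (hδ1 : δ < 1) (hε : 0 < ε) (hk : 2 ≤ S * A)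
    (hεH : ε < H * Real.log (S * A)) (hT : episodeBound S A H ε δ ≤ T) :
    (S * A) * (2 * Real.log (4 * S * A * H / δ)) ≤ T ∧
    16 * (H : ℝ) ^ 2 * Real.log (T + S * A) * Real.sqrt ((S * A) * T *
        (Real.log (4 * S * A * H / δ) + S * (1 + Real.log (T + S * A)))) +
      3 * (H : ℝ) ^ 2 * (S * A) * Real.log (T + S * A) ≤ ε * T := by
  obtain ⟨hL9, hkL, hBL⟩ := episodeBound_add_le hS hA hH hδ hδ1 hε hk hεH
  have hS1 : (1 : ℝ) ≤ S := by exact_mod_cast hS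
  have hA1 : (1 : ℝ) ≤ A := by exact_mod_cast hA
  have hH1 : (1 : ℝ) ≤ H := by exact_mod_cast hH
  have hg := log_confidence_ge_one hS hA hH hδ hδ1
  have hkR : (2 : ℝ) ≤ S * A := by exact_mod_cast hk
  have hlogk0 : 0 ≤ Real.log ((S : ℝ) * A) := Real.log_nonneg (by linarith)
  set L := logFactor S A H ε δ with hL
  set g := Real.log (4 * S * A * H / δ) with hgdef
  set B := episodeBound S A H ε δ with hB
  set k : ℝ := (S : ℝ) * A with hkdef
  set Λ := g + S * (1 + L) with hΛ
  have hΛg : g ≤ Λ := le_add_of_nonneg_right (by positivity)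
  have hB1 : 1 ≤ B ∧ 648 * L ^ 2 * (H : ℝ) ^ 4 * k * Λ / ε ^ 2 ≤ B := by
    have h1 : 648 * L ^ 2 * (H : ℝ) ^ 4 * k * Λ / ε ^ 2 ≤
        648 * (Real.log k + L) * (H : ℝ) ^ 4 * S * A * Λ * L / ε ^ 2 := by
      refine div_le_div_of_nonneg_right ?_ (by positivity)
      calc 648 * L ^ 2 * (H : ℝ) ^ 4 * k * Λ
          = (648 * (H : ℝ) ^ 4 * k * Λ * L) * L := by ring
        _ ≤ (648 * (H : ℝ) ^ 4 * k * Λ * L) * (Real.log k + L) :=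
            mul_le_mul_of_nonneg_left (by linarith) (by positivity)
        _ = _ := by rw [hkdef]; ring
    have h2 : 0 ≤ 2 * (H : ℝ) * S * A * (2 + L) / ε := by positivity
    have h3 : 0 ≤ 648 * L ^ 2 * (H : ℝ) ^ 4 * k * Λ / ε ^ 2 := by positivity
    have h4 : B = 1 + 648 * (Real.log k + L) * (H : ℝ) ^ 4 * S * A * Λ * L / ε ^ 2 +
      2 * (H : ℝ) * S * A * (2 + L) / ε := rfl
    constructor <;> linarith
  obtain ⟨hB1, hBmain⟩ := hB1
  have hB0 : 0 < B := by linarith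
  have hT0 : (0 : ℝ) < T := by linarith
  have hT1 : 1 ≤ (T : ℝ) / B := by rw [le_div_iff₀ hB0]; linarith
  -- With `T = u ^ 3 * B`, logarithms grow at most by a factor `u`. The squared main term has three
  -- logarithmic factors, so `u ^ 3` suffices to extend the bound from `B` to all `T ≥ B`.
  set u := Real.exp (Real.log (T / B) / 3) with hu
  have hu3 : u ^ 3 = T / B := by
    rw [hu, ← Real.exp_nat_mul]
    push_cast
    rw [mul_div_cancel₀ _ (by norm_num : (3 : ℝ) ≠ 0), Real.exp_log (by linarith)]
  have hu1 : 1 ≤ u := Real.one_le_exp (div_nonneg (Real.log_nonneg hT1) (by norm_num))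
  have hTB : (T : ℝ) = u ^ 3 * B := by rw [hu3]; field_simp
  have hlogu : Real.log (T / B) ≤ 3 * (u - 1) := by
    have := Real.add_one_le_exp (Real.log (T / B) / 3)
    rw [← hu] at this
    linarith
  set ℓ := Real.log (T + k) with hℓ
  have hℓ0 : 0 ≤ ℓ := Real.log_nonneg (by linarith)
  have hℓL : ℓ ≤ L * u := by
    have h1 : (T : ℝ) + k ≤ (B + k) * (T / B) := by
      have : (B + k) * (T / B) = T + k * (T / B) := by field_simp
      rw [this]
      linarith [le_mul_of_one_le_right (show 0 ≤ k by linarith) hT1]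
    have h2 := Real.log_le_log (by positivity) h1
    rw [Real.log_mul (by positivity) (by positivity)] at h2
    have h3 : 3 * (u - 1) ≤ L * (u - 1) :=
      mul_le_mul_of_nonneg_right (by linarith) (by linarith)
    linarith
  have hLHε : ε ≤ L * H := by
    have : (H : ℝ) * Real.log k ≤ H * L := mul_le_mul_of_nonneg_left hkL (by linarith)
    linarith
  have hBε : 648 * L ^ 2 * (H : ℝ) ^ 4 * k * Λ ≤ B * ε ^ 2 := by
    rwa [div_le_iff₀ (by positivity)] at hBmain
  -- One factor `ε` is traded for `L * H`, using `ε < H log k ≤ H L`; `hBconst` repeats this.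
  have hBlin : 648 * L * (H : ℝ) ^ 3 * k * Λ ≤ B * ε := by
    have h1 : 648 * L * (H : ℝ) ^ 3 * k * Λ * ε ≤ B * ε * ε := by
      calc 648 * L * (H : ℝ) ^ 3 * k * Λ * ε ≤ 648 * L * (H : ℝ) ^ 3 * k * Λ * (L * H) :=
            mul_le_mul_of_nonneg_left hLHε (by positivity)
        _ = 648 * L ^ 2 * (H : ℝ) ^ 4 * k * Λ := by ring
        _ ≤ B * ε ^ 2 := hBε
        _ = _ := by ring
    exact le_of_mul_le_mul_right h1 hε
  have hBconst : 648 * (H : ℝ) ^ 2 * k * Λ ≤ B := by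
    have h1 : 648 * (H : ℝ) ^ 2 * k * Λ * ε ≤ B * ε := by
      calc 648 * (H : ℝ) ^ 2 * k * Λ * ε ≤ 648 * (H : ℝ) ^ 2 * k * Λ * (L * H) :=
            mul_le_mul_of_nonneg_left hLHε (by positivity)
        _ = 648 * L * (H : ℝ) ^ 3 * k * Λ := by ring
        _ ≤ _ := hBlin
    exact le_of_mul_le_mul_right h1 hε
  constructor
  · have h1 : k * Λ ≤ (H : ℝ) ^ 2 * (k * Λ) :=
      le_mul_of_one_le_left (by positivity) (one_le_pow₀ hH1)
    have h2 : k * g ≤ k * Λ := mul_le_mul_of_nonneg_left hΛg (by linarith)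
    have h3 : 0 ≤ k * Λ := by positivity
    linarith
  · have hΛu : g + S * (1 + ℓ) ≤ u * Λ := by
      have h1 : (S : ℝ) * (1 + ℓ) ≤ S * (u * (1 + L)) :=
        mul_le_mul_of_nonneg_left (by linarith) (by linarith)
      have h2 : g ≤ u * g := le_mul_of_one_le_left (by linarith) hu1
      rw [hΛ]
      linarith
    -- The budget `ε T` is split as 2/3 and 1/3; here `256 / 648 ≤ (2 / 3) ^ 2`.
    have hfirst : 16 * (H : ℝ) ^ 2 * ℓ * Real.sqrt (k * T * (g + S * (1 + ℓ))) ≤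
        2 / 3 * (ε * T) := by
      refine abs_le_of_sq_le_sq' ?_ (by positivity) |>.2
      rw [mul_pow, Real.sq_sqrt (by positivity)]
      calc (16 * (H : ℝ) ^ 2 * ℓ) ^ 2 * (k * T * (g + S * (1 + ℓ)))
          = 256 * (H : ℝ) ^ 4 * k * T * (ℓ ^ 2 * (g + S * (1 + ℓ))) := by ring
        _ ≤ 256 * (H : ℝ) ^ 4 * k * T * ((L * u) ^ 2 * (u * Λ)) := by
            refine mul_le_mul_of_nonneg_left ?_ (by positivity)
            exact mul_le_mul (pow_le_pow_left₀ hℓ0 hℓL 2) hΛu (by positivity) (by positivity)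
        _ = 256 / 648 * (u ^ 3 * T) * (648 * L ^ 2 * (H : ℝ) ^ 4 * k * Λ) := by ring
        _ ≤ 256 / 648 * (u ^ 3 * T) * (B * ε ^ 2) :=
            mul_le_mul_of_nonneg_left hBε (by positivity)
        _ = 256 / 648 * ((u ^ 3 * B) * T * ε ^ 2) := by ring
        _ = 256 / 648 * (ε * T) ^ 2 := by rw [← hTB]; ring
        _ ≤ (2 / 3 * (ε * T)) ^ 2 := by
            have : 0 ≤ (ε * T) ^ 2 := sq_nonneg _
            rw [mul_pow]
            linarith
    have hsecond : 3 * (H : ℝ) ^ 2 * k * ℓ ≤ 1 / 3 * (ε * T) := by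
      have h1 : u ≤ u ^ 3 := le_self_pow₀ hu1 (by norm_num)
      have h2 : 1 ≤ H * Λ := one_le_mul_of_one_le_of_one_le hH1 (hg.trans hΛg)
      calc 3 * (H : ℝ) ^ 2 * k * ℓ ≤ 3 * (H : ℝ) ^ 2 * k * (L * u ^ 3) :=
            mul_le_mul_of_nonneg_left
              (hℓL.trans (mul_le_mul_of_nonneg_left h1 (by linarith))) (by positivity)
        _ ≤ 3 * (H : ℝ) ^ 2 * k * (L * u ^ 3) * (H * Λ) :=
            le_mul_of_one_le_right (by positivity) h2
        _ = 3 / 648 * u ^ 3 * (648 * L * (H : ℝ) ^ 3 * k * Λ) := by ring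
        _ ≤ 3 / 648 * u ^ 3 * (B * ε) := mul_le_mul_of_nonneg_left hBlin (by positivity)
        _ = 3 / 648 * ((u ^ 3 * B) * ε) := by ring
        _ = 3 / 648 * (ε * T) := by rw [← hTB]; ring
        _ ≤ _ := by
          have : 0 ≤ ε * T := by positivity
          linarith
    linarith

set_option maxHeartbeats 1000000 in
theorem ceil_episodeBound_le : ∃ C : ℝ, ∀ (S A H : ℕ) (_ : 0 < S) (_ : 0 < A) (_ : 0 < H)
    (ε δ : ℝ) (_ : 0 < ε) (_ : ε ≤ 1) (_ : 0 < δ) (_ : δ < 1),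
    (⌈episodeBound S A H ε δ⌉₊ : ℝ) ≤
      C * Real.log (4 * S * A * H / (δ * ε)) ^ 3 *
        ((H : ℝ) ^ 4 * S ^ 2 * A / ε ^ 2 + H * S * A / ε) := by
  -- The dominant coefficient below is `648 * 151 * 152 * 150`, about `2.23 * 10 ^ 9`.
  refine ⟨3000000000, fun S A H hS hA hH ε δ hε hε1 hδ hδ1 => ?_⟩
  have hS1 : (1 : ℝ) ≤ S := by exact_mod_cast hS
  have hA1 : (1 : ℝ) ≤ A := by exact_mod_cast hA
  have hH1 : (1 : ℝ) ≤ H := by exact_mod_cast hH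
  have hg := log_confidence_ge_one hS hA hH hδ hδ1
  have hk1 : (1 : ℝ) ≤ S * A := by nlinarith
  have hconf := one_le_confidence hS hA hH hδ hδ1
  set g := Real.log (4 * S * A * H / δ) with hgdef
  set G := Real.log (4 * S * A * H / (δ * ε)) with hG
  have hGg : G = g - Real.log ε := by
    rw [hG, hgdef, ← div_div, Real.log_div (by positivity) hε.ne']
  have hlogε : Real.log ε ≤ 0 := Real.log_nonpos hε.le hε1
  have hgG : g ≤ G := by linarith
  have hG1 : 1 ≤ G := by linarith
  have hpart : g = Real.log 4 + Real.log S + Real.log A + Real.log H - Real.log δ := by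
    rw [hgdef, Real.log_div (by positivity) hδ.ne', Real.log_mul (by positivity) (by positivity),
      Real.log_mul (by positivity) (by positivity), Real.log_mul (by positivity) (by positivity)]
  have h4 : 0 ≤ Real.log 4 := Real.log_nonneg (by norm_num)
  have hlS : 0 ≤ Real.log S := Real.log_nonneg hS1
  have hlA : 0 ≤ Real.log A := Real.log_nonneg hA1
  have hlH : 0 ≤ Real.log H := Real.log_nonneg hH1
  have hlδ : Real.log δ ≤ 0 := Real.log_nonpos hδ.le hδ1.le
  have hlk : Real.log ((S : ℝ) * A) = Real.log S + Real.log A :=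
    Real.log_mul (by positivity) (by positivity)
  have hl1010 : Real.log 1010 ≤ 10 := by
    rw [Real.log_le_iff_le_exp (by norm_num)]
    have := Real.exp_one_gt_d9
    calc (1010 : ℝ) ≤ 2 ^ 10 := by norm_num
      _ ≤ (Real.exp 1) ^ 10 := pow_le_pow_left₀ (by norm_num) (by linarith) 10
      _ = Real.exp 10 := by rw [← Real.exp_nat_mul]; norm_num
  have hlg := Real.log_le_sub_one_of_pos (show 0 < g by linarith)
  have hlg0 : 0 ≤ Real.log g := Real.log_nonneg hg
  have hl1010' : 0 ≤ Real.log 1010 := Real.log_nonneg (by norm_num)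
  have hL : logFactor S A H ε δ = 9 * (Real.log 1010 + (4 * Real.log H + 8 / 3 * Real.log S +
      8 / 3 * Real.log A + Real.log g) / 2 - Real.log ε) := by
    have hS8 : (0 : ℝ) < (S : ℝ) ^ (8 / 3 : ℝ) := Real.rpow_pos_of_pos (by linarith) _
    have hA8 : (0 : ℝ) < (A : ℝ) ^ (8 / 3 : ℝ) := Real.rpow_pos_of_pos (by linarith) _
    have hZ : 0 < (H : ℝ) ^ 4 * (S : ℝ) ^ (8 / 3 : ℝ) * (A : ℝ) ^ (8 / 3 : ℝ) * g := by
      positivity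
    rw [logFactor, ← hgdef, Real.log_div (by positivity) hε.ne',
      Real.log_mul (by norm_num) (Real.sqrt_pos.mpr hZ).ne', Real.log_sqrt hZ.le,
      Real.log_mul (by positivity) (by positivity), Real.log_mul (by positivity) (by positivity),
      Real.log_mul (by positivity) (by positivity), Real.log_rpow (by linarith),
      Real.log_rpow (by linarith), Real.log_pow]
    push_cast
    ring
  have hL0 : 0 ≤ logFactor S A H ε δ := by rw [hL]; linarith
  have hLG : logFactor S A H ε δ ≤ 150 * G := by rw [hL]; linarith
  set L := logFactor S A H ε δ
  have hceil : (⌈episodeBound S A H ε δ⌉₊ : ℝ) ≤ episodeBound S A H ε δ + 1 := by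
    refine (Nat.ceil_lt_add_one ?_).le
    unfold episodeBound
    have : 0 ≤ Real.log ((S : ℝ) * A) := by linarith
    positivity
  refine hceil.trans ?_
  have hG3 : G ≤ G ^ 3 := le_self_pow₀ hG1 (by norm_num)
  have hmain : 648 * (Real.log (S * A) + L) * (H : ℝ) ^ 4 * S * A * (g + S * (1 + L)) * L /
      ε ^ 2 ≤ 648 * 151 * 152 * 150 * G ^ 3 * ((H : ℝ) ^ 4 * S ^ 2 * A / ε ^ 2) := by
    rw [← mul_div_assoc]
    refine div_le_div_of_nonneg_right ?_ (by positivity)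
    have h1 : g + S * (1 + L) ≤ S * (152 * G) := by
      have h2 : g ≤ S * G := hgG.trans (le_mul_of_one_le_left (by linarith) hS1)
      have h3 : (S : ℝ) * (1 + L) ≤ S * (151 * G) :=
        mul_le_mul_of_nonneg_left (by linarith) (by linarith)
      linarith
    have h0 : 0 ≤ g + S * (1 + L) := by positivity
    calc 648 * (Real.log (S * A) + L) * (H : ℝ) ^ 4 * S * A * (g + S * (1 + L)) * L
        = 648 * (H : ℝ) ^ 4 * S * A * ((Real.log (S * A) + L) * ((g + S * (1 + L)) * L)) := by
          ring
      _ ≤ 648 * (H : ℝ) ^ 4 * S * A * ((151 * G) * ((S * (152 * G)) * (150 * G))) := by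
          refine mul_le_mul_of_nonneg_left ?_ (by positivity)
          refine mul_le_mul (by linarith) (mul_le_mul h1 hLG hL0 (by positivity))
            (by positivity) (by positivity)
      _ = _ := by ring
  have hHSA : 1 ≤ (H : ℝ) * S * A / ε := by
    rw [le_div_iff₀ hε]
    have : 1 ≤ (H : ℝ) * S * A := by exact_mod_cast Nat.mul_pos (Nat.mul_pos hH hS) hA
    linarith
  have hlast : 2 * (H : ℝ) * S * A * (2 + L) / ε ≤ 304 * G ^ 3 * (H * S * A / ε) := by
    calc 2 * (H : ℝ) * S * A * (2 + L) / ε = 2 * (2 + L) * (H * S * A / ε) := by ring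
      _ ≤ _ := mul_le_mul_of_nonneg_right (by linarith) (by linarith)
  have htwo : (2 : ℝ) ≤ 2 * G ^ 3 * (H * S * A / ε) := by
    have : 1 ≤ G ^ 3 := by linarith
    nlinarith
  have hX : 0 ≤ G ^ 3 * ((H : ℝ) ^ 4 * S ^ 2 * A / ε ^ 2) := by positivity
  have hY : 0 ≤ G ^ 3 * ((H : ℝ) * S * A / ε) := by positivity
  have hB : episodeBound S A H ε δ + 1 = 2 + 648 * (Real.log (S * A) + L) * (H : ℝ) ^ 4 * S * A *
      (g + S * (1 + L)) * L / ε ^ 2 + 2 * (H : ℝ) * S * A * (2 + L) / ε := by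
    rw [episodeBound]; ring
  have hC : 3000000000 * G ^ 3 * ((H : ℝ) ^ 4 * S ^ 2 * A / ε ^ 2 + H * S * A / ε) =
      3000000000 * (G ^ 3 * ((H : ℝ) ^ 4 * S ^ 2 * A / ε ^ 2)) +
        3000000000 * (G ^ 3 * (H * S * A / ε)) := by ring
  rw [hB, hC]
  linarith

end Numerics

/-! ### Union bound ignoring null outcomes. -/

section UnionBound

theorem one_sub_le_of_union {X ι : Type*} [Fintype X] [Fintype ι] {P : X → ℝ}
    (hP : ∀ x, 0 ≤ P x) (hP1 : ∑ x, P x = 1) {G : Set X} {E : ι → Set X} {p : ι → ℝ}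
    (hE : ∀ j, ∑ x, (E j).indicator P x ≤ p j)
    (hG : ∀ x, P x ≠ 0 → (∀ j, x ∉ E j) → x ∈ G) :
    1 - ∑ j, p j ≤ ∑ x, G.indicator P x := by
  have h1 : ∀ x, P x ≤ G.indicator P x + ∑ j, (E j).indicator P x := by
    intro x
    have hnn : ∀ j, 0 ≤ (E j).indicator P x := fun j => Set.indicator_nonneg (fun x _ => hP x) x
    by_cases hx : x ∈ G
    · rw [Set.indicator_of_mem hx]
      linarith [Finset.sum_nonneg fun j (_ : j ∈ Finset.univ) => hnn j]
    · rw [Set.indicator_of_notMem hx, zero_add]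
      by_cases h0 : P x = 0
      · rw [h0]; exact Finset.sum_nonneg fun j _ => h0 ▸ hnn j
      · obtain ⟨j, hj⟩ : ∃ j, x ∈ E j := by
          by_contra hcon
          push Not at hcon
          exact hx (hG x h0 hcon)
        refine le_trans (le_of_eq (Set.indicator_of_mem hj P).symm) ?_
        exact Finset.single_le_sum (fun j _ => hnn j) (Finset.mem_univ j)
  have h2 := Finset.sum_le_sum fun x (_ : x ∈ Finset.univ) => h1 x
  rw [hP1, Finset.sum_add_distrib, Finset.sum_comm] at h2
  have h3 := Finset.sum_le_sum fun j (_ : j ∈ Finset.univ) => hE j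
  linarith

end UnionBound

/-! ### Bounds on entropies, confidence thresholds and total regret. -/

section PAC

variable {S A : Type*} [Fintype S] [DecidableEq S] [Fintype A] [DecidableEq A] {H : ℕ}

theorem visitationEntropy_le_log {M : MDP S A H} {q : Episode S A H → ℝ} (hq : IsEpisodeLaw M q)
    [Nonempty A] :
    visitationEntropy (visitation q) ≤ H * Real.log (Fintype.card S * Fintype.card A) := by
  have : Nonempty S := ⟨M.init⟩
  have h : ∀ h : Fin H, ∑ x : S × A, Real.negMulLog (visitation q h x) ≤
      Real.log (Fintype.card S * Fintype.card A) := by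
    intro h
    have := sum_negMulLog_le_log_card (visitation_nonneg hq h) (sum_visitation hq h)
    rwa [Fintype.card_prod, Nat.cast_mul] at this
  refine (Finset.sum_le_sum fun i _ => h i).trans ?_
  rw [Finset.sum_const, Finset.card_univ, Fintype.card_fin, nsmul_eq_mul]

theorem visitationEntropy_mixtureLaw_nonneg (M : MDP S A H) (pol : SamplingRule S A H) {T : ℕ}
    (ω : Fin T → Episode S A H) : 0 ≤ visitationEntropy (visitation (mixtureLaw M pol ω)) := by
  refine Finset.sum_nonneg fun h _ => Finset.sum_nonneg fun x _ => ?_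
  rw [visitation_mixtureLaw]
  have hlaw : ∀ t : Fin T, IsEpisodeLaw M ((pol.at ω t).law M) := fun t =>
    (pol.at ω t).isEpisodeLaw M
  have h1 : ∀ t : Fin T, visitation ((pol.at ω t).law M) h x ≤ 1 := fun t =>
    sum_visitation (hlaw t) h ▸ Finset.single_le_sum
      (fun x _ => visitation_nonneg (hlaw t) h x) (Finset.mem_univ x)
  refine Real.negMulLog_nonneg (div_nonneg (Finset.sum_nonneg fun t _ =>
    visitation_nonneg (hlaw t) h x) (Nat.cast_nonneg _)) (div_le_one_of_le₀ ?_ (Nat.cast_nonneg _))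
  refine (Finset.sum_le_sum fun t _ => h1 t).trans ?_
  simp

theorem alphaKL_le {S A H T n : ℕ} {δ : ℝ} (hS : 0 < S) (hA : 0 < A) (hH : 0 < H)
    (hδ : 0 < δ) (hδ1 : δ < 1) (hn : n ≤ T) :
    0 ≤ alphaKL S A H δ n ∧ alphaKL S A H δ n ≤
      Real.log (4 * S * A * H / δ) + S * (1 + Real.log (T + S * A)) := by
  have hconf := one_le_confidence hS hA hH hδ hδ1
  have hnR : (n : ℝ) ≤ T := by exact_mod_cast hn
  have hn0 : (0 : ℝ) ≤ n := Nat.cast_nonneg _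
  have hk : (1 : ℝ) ≤ S * A := by exact_mod_cast Nat.mul_pos hS hA
  have h1 : Real.log (Real.exp 1 * (1 + n)) = 1 + Real.log (1 + n) := by
    rw [Real.log_mul (Real.exp_pos _).ne' (by positivity), Real.log_exp]
  have e2 : 2 * (S : ℝ) * A * H / δ = 2 * (S * A * H / δ) := by ring
  have e4 : 4 * (S : ℝ) * A * H / δ = 4 * (S * A * H / δ) := by ring
  unfold alphaKL
  rw [h1, e2, e4]
  constructor
  · have h2 : 0 ≤ Real.log (2 * ((S : ℝ) * A * H / δ)) := Real.log_nonneg (by linarith)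
    have h3 : 0 ≤ Real.log (1 + (n : ℝ)) := Real.log_nonneg (by linarith)
    positivity
  · refine add_le_add (Real.log_le_log (by linarith) (by linarith)) ?_
    refine mul_le_mul_of_nonneg_left ?_ (Nat.cast_nonneg _)
    have := Real.log_le_log (show 0 < 1 + (n : ℝ) by linarith)
      (show 1 + (n : ℝ) ≤ T + S * A by linarith)
    linarith

theorem accurateTrans_of_transRatio_lt {M : MDP S A H} [Nonempty A] {t : ℕ}
    {ω : Fin t → Episode S A H} {δ : ℝ} (hH : 0 < H) (hδ : 0 < δ) (hδ1 : δ < 1)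
    (hsupp : ∀ (i : Fin t) (h : Fin H),
      M.p h ((ω i).1 h.castSucc) ((ω i).2 h) ((ω i).1 h.succ) ≠ 0)
    (hratio : ∀ h s a, transRatio M h s a t ω <
      2 * Fintype.card S * Fintype.card A * H / δ) : AccurateTrans M δ ω := by
  intro h s a hn V hV0 hV
  set ℓ := Real.log (t + Fintype.card S * Fintype.card A) with hℓ
  have hℓ0 : 0 ≤ ℓ := log_range_nonneg t s
  have hα := (alphaKL_le (Fintype.card_pos_iff.mpr ⟨s⟩) (Fintype.card_pos_iff.mpr ⟨a⟩) hH hδ hδ1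
    (le_refl (count ω h s a))).1
  refine (abs_empTrans_sub_mul_le (fun i => hsupp i h) (hratio h s a) (Nat.pos_of_ne_zero hn)
    hV0 hV (by positivity)).trans ?_
  refine Real.le_sqrt_of_sq_le ?_
  set α := alphaKL (Fintype.card S) (Fintype.card A) H δ (count ω h s a)
  set n : ℝ := (count ω h s a : ℝ) with hnR
  have hn0 : 0 ≤ n := Nat.cast_nonneg _
  rw [mul_pow, Real.sq_sqrt (by positivity)]
  have : 0 ≤ (ℓ * H) ^ 2 * (α / n) := by positivity
  -- The bonus contains a factor 2 under the root that this concentration bound does not need.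
  calc (ℓ * H) ^ 2 * (α / n) ≤ 2 * ((ℓ * H) ^ 2 * (α / n)) := by linarith
    _ = _ := by ring

theorem two_mul_realBonus_le {δ : ℝ} (hH : 0 < H) (hδ : 0 < δ) (hδ1 : δ < 1) {t T : ℕ}
    (htT : t ≤ T) (ω : Fin t → Episode S A H) (h : Fin H) (s : S) (a : A) :
    2 * realBonus δ ω h s a ≤ 2 * Real.sqrt (2 * (Real.log (T + Fintype.card S *
      Fintype.card A) * H) ^ 2 * (Real.log (4 * Fintype.card S * Fintype.card A * H / δ) +
        Fintype.card S * (1 + Real.log (T + Fintype.card S * Fintype.card A)))) /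
      Real.sqrt (count ω h s a) := by
  have hα := alphaKL_le (T := T) (Fintype.card_pos_iff.mpr ⟨s⟩) (Fintype.card_pos_iff.mpr ⟨a⟩)
    hH hδ hδ1 ((count_le ω h s a).trans htT)
  have hk := one_le_card_mul_card s a
  have ht : (t : ℝ) ≤ T := by exact_mod_cast htT
  have ht0 : (0 : ℝ) ≤ t := Nat.cast_nonneg _
  have hℓ0 : 0 ≤ Real.log (t + Fintype.card S * Fintype.card A) := Real.log_nonneg (by linarith)
  have hℓ := Real.log_le_log (show 0 < (t : ℝ) + Fintype.card S * Fintype.card A by linarith)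
    (show (t : ℝ) + Fintype.card S * Fintype.card A ≤ T + Fintype.card S * Fintype.card A by
      linarith)
  rw [mul_div_assoc, ← Real.sqrt_div' _ (Nat.cast_nonneg _)]
  refine mul_le_mul_of_nonneg_left (Real.sqrt_le_sqrt ?_) (by norm_num)
  refine div_le_div_of_nonneg_right ?_ (Nat.cast_nonneg _)
  refine mul_le_mul ?_ hα.2 hα.1 (by positivity)
  rw [mul_pow, mul_assoc, mul_comm ((H : ℝ) ^ 2)]
  refine mul_le_mul_of_nonneg_left ?_ (by norm_num)
  exact mul_le_mul_of_nonneg_right (pow_le_pow_left₀ hℓ0 hℓ 2) (by positivity)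

/-- The bonuses, the forecaster's regret and the deviations add up to the accuracy. -/
theorem total_regret_le {H k T ℓ ℓ₁ Λ β ε : ℝ} (hH : 1 ≤ H) (hk : 1 ≤ k) (hT : 0 ≤ T)
    (hℓ : 1 ≤ ℓ) (hℓ₁ : ℓ₁ ≤ ℓ) (hΛ : 0 ≤ Λ) (hβΛ : β ≤ 2 * Λ)
    (h : 16 * H ^ 2 * ℓ * Real.sqrt (k * T * Λ) + 3 * H ^ 2 * k * ℓ ≤ ε * T) :
    4 * H ^ 2 * ℓ * Real.sqrt (β * T) + H * (k * (ℓ * H) +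
      5 / 2 * (2 * Real.sqrt (2 * (ℓ * H) ^ 2 * Λ)) * Real.sqrt (k * T) + k +
      ℓ * (2 * Real.sqrt (k * β * T)) + k * ℓ₁) ≤ ε * T := by
  set X := Real.sqrt (k * T * Λ) with hX
  have hX0 : 0 ≤ X := Real.sqrt_nonneg _
  have hX2 : X ^ 2 = k * T * Λ := Real.sq_sqrt (by positivity)
  have hTΛ : 0 ≤ T * Λ := by positivity
  have hTβ : β * T ≤ 2 * (T * Λ) := by
    have := mul_le_mul_of_nonneg_right hβΛ hT
    linarith
  have hkTΛ : T * Λ ≤ k * T * Λ := by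
    have := le_mul_of_one_le_left hTΛ hk
    linarith
  -- `17 / 12` is a rational upper bound for `√2`.
  have h1 : Real.sqrt (β * T) ≤ 17 / 12 * X := by
    rw [Real.sqrt_le_left (by positivity), mul_pow, hX2]
    linarith
  have h2 : Real.sqrt (k * β * T) ≤ 17 / 12 * X := by
    rw [Real.sqrt_le_left (by positivity), mul_pow, hX2]
    have h5 := mul_le_mul_of_nonneg_left hTβ (show 0 ≤ k by linarith)
    have h6 : 0 ≤ k * T * Λ := by positivity
    linarith
  have h3 : Real.sqrt (2 * (ℓ * H) ^ 2 * Λ) * Real.sqrt (k * T) ≤ 17 / 12 * (ℓ * H * X) := by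
    rw [← Real.sqrt_mul (by positivity), Real.sqrt_le_left (by positivity),
      show (17 / 12 * (ℓ * H * X)) ^ 2 = 289 / 144 * ((ℓ * H) ^ 2 * X ^ 2) by ring, hX2]
    have h6 : 0 ≤ (ℓ * H) ^ 2 * (k * T * Λ) := by positivity
    linarith
  have hH2 : H ≤ H ^ 2 := le_self_pow₀ hH (by norm_num)
  have a1 := mul_le_mul_of_nonneg_left h1 (show 0 ≤ 4 * H ^ 2 * ℓ by positivity)
  have a2 : H * (ℓ * (2 * Real.sqrt (k * β * T))) ≤ 17 / 6 * (H ^ 2 * ℓ * X) := by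
    calc H * (ℓ * (2 * Real.sqrt (k * β * T))) ≤ H ^ 2 * (ℓ * (2 * (17 / 12 * X))) :=
          mul_le_mul hH2 (mul_le_mul_of_nonneg_left
            (mul_le_mul_of_nonneg_left h2 (by norm_num)) (by linarith))
            (by positivity) (by positivity)
      _ = _ := by ring
  have a3 := mul_le_mul_of_nonneg_left h3 (show 0 ≤ 5 * H by positivity)
  have a4 : H * k ≤ H ^ 2 * k * ℓ := by
    calc H * k ≤ H ^ 2 * k := mul_le_mul_of_nonneg_right hH2 (by linarith)
      _ ≤ _ := le_mul_of_one_le_right (by positivity) hℓ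
  have a5 : H * (k * ℓ₁) ≤ H ^ 2 * k * ℓ := by
    calc H * (k * ℓ₁) ≤ H ^ 2 * (k * ℓ) :=
          (mul_le_mul_of_nonneg_left (mul_le_mul_of_nonneg_left hℓ₁ (by linarith))
            (by linarith)).trans (mul_le_mul_of_nonneg_right hH2 (by positivity))
      _ = _ := by ring
  have a6 : 0 ≤ H ^ 2 * ℓ * X := by positivity
  have e : H * (k * (ℓ * H) + 5 / 2 * (2 * Real.sqrt (2 * (ℓ * H) ^ 2 * Λ)) * Real.sqrt (k * T) +
      k + ℓ * (2 * Real.sqrt (k * β * T)) + k * ℓ₁) =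
      H ^ 2 * k * ℓ + 5 * H * (Real.sqrt (2 * (ℓ * H) ^ 2 * Λ) * Real.sqrt (k * T)) + H * k +
        H * (ℓ * (2 * Real.sqrt (k * β * T))) + H * (k * ℓ₁) := by ring
  -- The multiples of `H ^ 2 * ℓ * X` add up to `17/3 + 17/6 + 85/12 = 187/12 ≤ 16`, and the three
  -- lower-order terms give `3 * H ^ 2 * k * ℓ`.
  rw [e]
  linarith

end PAC

/-! ### High-probability events and the PAC guarantee. -/

section Main

variable {S A : Type*} [Fintype S] [DecidableEq S] [Fintype A] [DecidableEq A] {H : ℕ}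

/-- The sampled optimistic return of the `(t + 1)`-st episode. -/
def optimisticReturn (R c : ℝ) (t : ℕ) (ω : Fin t → Episode S A H) (m : Episode S A H) : ℝ :=
  ∑ h : Fin H, (reward ω h (m.1 h.castSucc) (m.2 h) +
    planError R c (count ω h (m.1 h.castSucc) (m.2 h)))

theorem planError_mem {R c : ℝ} (hR : 0 ≤ R) (hc : 0 ≤ c) (n : ℕ) :
    0 ≤ planError R c n ∧ planError R c n ≤ R := by
  unfold planError
  split_ifs
  · exact ⟨hR, le_rfl⟩
  · exact ⟨le_min hR (by positivity), min_le_left _ _⟩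

/-- Truncating `planError` at `R` bounds each step by `ℓ + ℓ * H`, so the return can be normalised
for the deviation inequality. -/
theorem optimisticReturn_mem {ℓ c : ℝ} (hℓ : 0 ≤ ℓ) (hc : 0 ≤ c) (hH : 0 < H) {t : ℕ}
    (ht : Real.log (t + Fintype.card S * Fintype.card A) ≤ ℓ)
    (ω : Fin t → Episode S A H) (m : Episode S A H) :
    0 ≤ optimisticReturn (ℓ * H) c t ω m ∧
      optimisticReturn (ℓ * H) c t ω m ≤ 2 * H ^ 2 * ℓ := by
  have hH1 : (1 : ℝ) ≤ H := by exact_mod_cast hH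
  have hR : 0 ≤ ℓ * H := by positivity
  have h1 := fun n => planError_mem hR hc n
  refine ⟨Finset.sum_nonneg fun h _ => add_nonneg (reward_nonneg _ _ _ _) (h1 _).1, ?_⟩
  refine (Finset.sum_le_sum (g := fun _ => 2 * (ℓ * H)) fun h _ => ?_).trans (le_of_eq ?_)
  · have h2 := (reward_le ω h (m.1 h.castSucc) (m.2 h)).trans ht
    have h3 := (h1 (count ω h (m.1 h.castSucc) (m.2 h))).2
    have h4 : ℓ ≤ ℓ * H := le_mul_of_one_le_right hℓ hH1
    linarith
  · rw [Finset.sum_const, Finset.card_univ, Fintype.card_fin, nsmul_eq_mul]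
    ring

/-- Visit counts and visitation probabilities deviate little from each other. -/
theorem prob_count_deviation_le (M : MDP S A H) (pol : SamplingRule S A H) (T : ℕ) (h : Fin H)
    (x : S × A) {lam β : ℝ} (hl : 0 < lam) (hl1 : lam ≤ 1) {σ : ℝ} (hσ : |σ| = 1) :
    ∑ ω, Set.indicator {ω : Fin T → Episode S A H |
      lam * (∑ t : Fin T, visitation ((pol.at ω t).law M) h x) + β / lam ≤
        σ * (count ω h x.1 x.2 - ∑ t : Fin T, visitation ((pol.at ω t).law M) h x)}
      (seqProb (pol.kernel M) T) ω ≤ Real.exp (-β) := by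
  have hdev := sum_sub_expect_deviation (pol.kernel_nonneg M) (pol.sum_kernel M)
    (fun _ _ m => σ * if m.pair h = x then 1 else 0) T
    (fun t _ ω m => by
      rw [abs_mul, hσ, one_mul]
      split_ifs <;> norm_num) (β := β) hl hl1
  convert hdev using 4 with ω
  ext ω
  have hv : ∀ t : Fin T, ∑ m, pol.kernel M t (fun i => ω (i.castLE t.isLt.le)) m *
      (if m.pair h = x then (1 : ℝ) else 0) = visitation ((pol.at ω t).law M) h x := by
    intro t
    refine Finset.sum_congr rfl fun m _ => ?_
    rw [mul_ite, mul_one, mul_zero]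
    rfl
  have habs : ∀ m : Episode S A H, |σ * if m.pair h = x then (1 : ℝ) else 0| =
      if m.pair h = x then 1 else 0 := by
    intro m
    rw [abs_mul, hσ, one_mul]
    split_ifs <;> norm_num
  have hcount : ∑ t : Fin T, (if (ω t).pair h = x then (1 : ℝ) else 0) = count ω h x.1 x.2 := by
    simp [count]
  simp only [Set.mem_ofPred_eq, habs, hv]
  have hpull : ∀ t : Fin T, ∑ m, pol.kernel M t (fun i => ω (i.castLE t.isLt.le)) m *
      (σ * if m.pair h = x then (1 : ℝ) else 0) =
      σ * visitation ((pol.at ω t).law M) h x := by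
    intro t
    rw [← hv, Finset.mul_sum]
    exact Finset.sum_congr rfl fun m _ => by ring
  simp only [hpull, ← mul_sub, ← Finset.mul_sum, Finset.sum_sub_distrib, hcount]

theorem prob_return_deviation_le (M : MDP S A H) (pol : SamplingRule S A H) (T : ℕ) {ℓ c : ℝ}
    (hℓ : 0 < ℓ) (hc : 0 ≤ c) (hH : 0 < H)
    (ht : ∀ t < T, Real.log ((t : ℕ) + Fintype.card S * Fintype.card A) ≤ ℓ)
    {lam β : ℝ} (hl : 0 < lam) (hl1 : lam ≤ 1) :
    ∑ ω, Set.indicator {ω : Fin T → Episode S A H |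
      2 * H ^ 2 * ℓ * (lam * T + β / lam) ≤
        ∑ t : Fin T, ∑ m, (pol.at ω t).law M m *
          optimisticReturn (ℓ * H) c t (fun i : Fin t => ω (i.castLE t.isLt.le)) m -
        ∑ t : Fin T, optimisticReturn (ℓ * H) c t
          (fun i : Fin t => ω (i.castLE t.isLt.le)) (ω t)}
      (seqProb (pol.kernel M) T) ω ≤ Real.exp (-β) := by
  have hH0 : (0 : ℝ) < H := by exact_mod_cast hH
  set N := 2 * (H : ℝ) ^ 2 * ℓ with hN
  have hN0 : 0 < N := by positivity
  have hle1 : ∀ t < T, ∀ (ω : Fin t → Episode S A H) (m : Episode S A H),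
      |-(optimisticReturn (ℓ * H) c t ω m / N)| ≤ 1 := by
    intro t htT ω m
    have := optimisticReturn_mem hℓ.le hc hH (ht t htT) ω m
    rw [abs_neg, abs_of_nonneg (div_nonneg this.1 hN0.le), div_le_one₀ hN0]
    exact this.2
  -- The sign is reversed because expected returns have to be bounded by sampled ones.
  have hdev := sum_sub_expect_deviation (pol.kernel_nonneg M) (pol.sum_kernel M)
    (fun t ω m => -(optimisticReturn (ℓ * H) c t ω m / N)) T hle1 (β := β) hl hl1
  refine le_trans (Finset.sum_le_sum fun ω _ => ?_) hdev
  refine Set.indicator_le_indicator_of_subset (fun ω hω => ?_)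
    (fun ω => seqProb_nonneg (pol.kernel_nonneg M) _ _) ω
  have hω' : N * (lam * T + β / lam) ≤ _ := hω
  rw [← le_div_iff₀' hN0, sub_div, Finset.sum_div, Finset.sum_div] at hω'
  simp only [Set.mem_ofPred_eq]
  have habs : ∑ t : Fin T, ∑ m, pol.kernel M t (fun i => ω (i.castLE t.isLt.le)) m *
      |-(optimisticReturn (ℓ * H) c t (fun i : Fin t => ω (i.castLE t.isLt.le)) m / N)| ≤ T := by
    refine (Finset.sum_le_sum (g := fun _ => (1 : ℝ)) fun t _ => ?_).trans (by simp)
    rw [← pol.sum_kernel M t fun i => ω (i.castLE t.isLt.le)]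
    exact Finset.sum_le_sum fun m _ =>
      mul_le_of_le_one_right (pol.kernel_nonneg M _ _ _) (hle1 t t.isLt _ _)
  have hpull : ∀ t : Fin T, ∑ m, pol.kernel M t (fun i => ω (i.castLE t.isLt.le)) m *
      -(optimisticReturn (ℓ * H) c t (fun i : Fin t => ω (i.castLE t.isLt.le)) m / N) =
      -((∑ m, (pol.at ω t).law M m *
        optimisticReturn (ℓ * H) c t (fun i : Fin t => ω (i.castLE t.isLt.le)) m) / N) := by
    intro t
    rw [Finset.sum_div, ← Finset.sum_neg_distrib]
    refine Finset.sum_congr rfl fun m _ => ?_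
    rw [SamplingRule.kernel, SamplingRule.at]
    ring
  simp only [hpull, sub_neg_eq_add, Finset.sum_add_distrib, Finset.sum_neg_distrib]
  have := mul_le_mul_of_nonneg_left habs hl.le
  linarith

theorem isPAC_of_mul_log_le {M : MDP S A H} [Nonempty A] {ε δ : ℝ} (hδ : 0 < δ)
    (pol : SamplingRule S A H) (T : ℕ)
    (hε : H * Real.log (Fintype.card S * Fintype.card A) ≤ ε) :
    IsPAC M pol T (mixtureLaw M pol) ε δ := by
  unfold IsPAC
  have hset : {ω : Fin T → Episode S A H | ∀ ψ : GeneralPolicy S A H,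
      visitationEntropy (visitation (ψ.law M)) -
        visitationEntropy (visitation (mixtureLaw M pol ω)) ≤ ε} = Set.univ := by
    refine Set.eq_univ_of_forall fun ω ψ => ?_
    have h1 := visitationEntropy_le_log (ψ.isEpisodeLaw M)
    have h2 := visitationEntropy_mixtureLaw_nonneg M pol ω
    linarith
  rw [hset, runProb]
  simp only [Set.indicator_univ]
  have : ∑ ω : Fin T → Episode S A H, ∏ t : Fin T, (pol.at ω t).law M (ω t) = 1 :=
    sum_seqProb (pol.sum_kernel M) T
  rw [this]
  linarith

theorem entGame_isPAC {M : MDP S A H} [Nonempty A] (hH : 0 < H) {ε δ : ℝ} (hε : 0 < ε)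
    (hδ : 0 < δ) (hδ1 : δ < 1) {pol : SamplingRule S A H} (hpol : IsEntGame 1 δ pol) {T : ℕ}
    (hT : 0 < T) (hB : episodeBound (Fintype.card S) (Fintype.card A) H ε δ ≤ T) :
    IsPAC M pol T (mixtureLaw M pol) ε δ := by
  rcases le_or_gt (H * Real.log (Fintype.card S * Fintype.card A)) ε with hεH | hεH
  · exact isPAC_of_mul_log_le hδ pol T hεH
  have hS : 0 < Fintype.card S := Fintype.card_pos_iff.mpr ⟨M.init⟩
  have hA : 0 < Fintype.card A := Fintype.card_pos
  -- A single state-action pair would give `log 1 = 0` and contradict `ε < H log (S A)`.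
  have hk : 2 ≤ Fintype.card S * Fintype.card A := by
    by_contra hlt
    have h1 : Fintype.card S * Fintype.card A = 1 := by
      have := Nat.mul_pos hS hA
      omega
    have h2 : (Fintype.card S : ℝ) * Fintype.card A = 1 := by exact_mod_cast h1
    rw [h2, Real.log_one, mul_zero] at hεH
    linarith
  obtain ⟨hkT, hnum⟩ := regret_le_of_episodeBound_le hS hA hH hδ hδ1 hε hk hεH hB
  have hg := log_confidence_ge_one hS hA hH hδ hδ1
  have hconf := one_le_confidence hS hA hH hδ hδ1
  have hTR : (0 : ℝ) < T := by exact_mod_cast hT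
  have hT1 : (1 : ℝ) ≤ T := by exact_mod_cast hT
  have hH1 : (1 : ℝ) ≤ H := by exact_mod_cast hH
  have hkR : (2 : ℝ) ≤ Fintype.card S * Fintype.card A := by exact_mod_cast hk
  have hcardk : ((Fintype.card (S × A) : ℕ) : ℝ) = Fintype.card S * Fintype.card A := by
    rw [Fintype.card_prod, Nat.cast_mul]
  set k : ℝ := (Fintype.card S : ℝ) * Fintype.card A with hkdef
  set ℓ := Real.log (T + k) with hℓ
  set g := Real.log (4 * Fintype.card S * Fintype.card A * H / δ) with hgdef
  set Λ := g + Fintype.card S * (1 + ℓ) with hΛ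
  have hℓ1 : 1 ≤ ℓ := by
    rw [hℓ, Real.le_log_iff_exp_le (by linarith)]
    have := Real.exp_one_lt_d9
    linarith
  have hgΛ : g ≤ Λ := le_add_of_nonneg_right (by positivity)
  set w := k * H / δ with hw
  have hw1 : 1 ≤ w := hconf
  set β := Real.log (8 * w) with hβ
  have hg' : g = Real.log (4 * w) := by
    rw [hgdef, hw, hkdef]
    congr 1
    ring
  have hβg : β ≤ 2 * g := by
    have h2 : Real.log 2 ≤ g := by
      rw [hg']; exact Real.log_le_log (by norm_num) (by linarith)
    have h3 : β = Real.log 2 + g := by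
      rw [hβ, hg', ← Real.log_mul (by norm_num) (by positivity)]
      congr 1
      ring
    linarith
  have hβ0 : 0 < β := Real.log_pos (by linarith)
  have hexp : Real.exp (-β) = 1 / (8 * w) := by
    rw [Real.exp_neg, hβ, Real.exp_log (by linarith), one_div]
  have hkβ : k * β ≤ T := (mul_le_mul_of_nonneg_left hβg (by linarith)).trans hkT
  have hβT : β ≤ T := (le_mul_of_one_le_left hβ0.le (by linarith)).trans hkβ
  -- The choice `√(b / T)` balances `lam * T` with `b / lam`. It is an admissible parameter because
  -- `b ≤ T`, which `hkT` supplies for `b = k * β` and a fortiori for `b = β`.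
  have hparam : ∀ {b : ℝ}, 0 < b → b ≤ T → 0 < Real.sqrt (b * T) / T ∧
      Real.sqrt (b * T) / T ≤ 1 ∧ Real.sqrt (b * T) / T * T = Real.sqrt (b * T) ∧
      b / (Real.sqrt (b * T) / T) = Real.sqrt (b * T) := by
    intro b hb hbT
    have hpos : 0 < Real.sqrt (b * T) := Real.sqrt_pos.mpr (by positivity)
    refine ⟨by positivity, ?_, div_mul_cancel₀ _ hTR.ne', ?_⟩
    · rw [div_le_one₀ hTR, Real.sqrt_le_left hTR.le, sq]
      exact mul_le_mul_of_nonneg_right hbT hTR.le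
    · rw [div_div_eq_mul_div, div_eq_iff hpos.ne', Real.mul_self_sqrt (by positivity)]
  obtain ⟨hl0, hl1, hlT, hlβ⟩ := hparam hβ0 hβT
  obtain ⟨hm0, hm1, hmT, hmβ⟩ := hparam (mul_pos (by linarith : 0 < k) hβ0) hkβ
  set lam := Real.sqrt (k * β * T) / T with hlam
  set lam' := Real.sqrt (β * T) / T with hlam'
  set R := ℓ * H with hR
  set c := 2 * Real.sqrt (2 * (ℓ * H) ^ 2 * Λ) with hc
  have hR0 : 0 ≤ R := by positivity
  have hc0 : 0 ≤ c := by positivity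
  have hℓt : ∀ t < T, Real.log ((t : ℕ) + k) ≤ ℓ := by
    intro t ht
    have h1 : (t : ℝ) ≤ T := by exact_mod_cast ht.le
    have h2 : (0 : ℝ) ≤ t := Nat.cast_nonneg _
    exact Real.log_le_log (by linarith) (by linarith)
  let P := seqProb (pol.kernel M) T
  let J := Fin H × S × A
  let D : (Fin T → Episode S A H) → Fin H → S × A → ℝ := fun ω h x =>
    ∑ t : Fin T, visitation ((pol.at ω t).law M) h x
  let E : J ⊕ J ⊕ J ⊕ Unit → Set (Fin T → Episode S A H) :=
    Sum.elim (fun j => {ω | ∃ (t : ℕ) (ht : t ≤ T),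
      2 * w ≤ transRatio M j.1 j.2.1 j.2.2 t (fun i => ω (i.castLE ht))}) <|
    Sum.elim (fun j => {ω | lam * D ω j.1 j.2 + β / lam ≤
      1 * (count ω j.1 j.2.1 j.2.2 - D ω j.1 j.2)}) <|
    Sum.elim (fun j => {ω | lam * D ω j.1 j.2 + β / lam ≤
      (-1) * (count ω j.1 j.2.1 j.2.2 - D ω j.1 j.2)})
      (fun _ => {ω | 2 * H ^ 2 * ℓ * (lam' * T + β / lam') ≤
        ∑ t : Fin T, ∑ m, (pol.at ω t).law M m *
          optimisticReturn R c t (fun i : Fin t => ω (i.castLE t.isLt.le)) m -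
        ∑ t : Fin T, optimisticReturn R c t (fun i : Fin t => ω (i.castLE t.isLt.le)) (ω t)})
  -- With `w * δ` triples `(h, s, a)`, transitions fail with probability at most `δ / 2`, the two
  -- signs of count deviation at most `δ / 4`, and the return at most `δ / 8`.
  let p : J ⊕ J ⊕ J ⊕ Unit → ℝ :=
    Sum.elim (fun _ => 1 / (2 * w)) fun _ => 1 / (8 * w)
  have hEp : ∀ j, ∑ ω, (E j).indicator P ω ≤ p j := by
    rintro (j | j | j | j)
    · exact prob_transRatio_ge_le M pol j.1 j.2.1 j.2.2 T (by linarith)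
    · exact (prob_count_deviation_le M pol T j.1 j.2 hm0 hm1 (by norm_num)).trans hexp.le
    · exact (prob_count_deviation_le M pol T j.1 j.2 hm0 hm1 (by norm_num)).trans hexp.le
    · exact (prob_return_deviation_le M pol T (by linarith) hc0 hH hℓt hl0 hl1).trans hexp.le
  have hpsum : ∑ j, p j ≤ δ := by
    have hJ : ((Fintype.card J : ℕ) : ℝ) = w * δ := by
      simp only [J, Fintype.card_prod, Fintype.card_fin, Nat.cast_mul]
      rw [hw, div_mul_cancel₀ _ hδ.ne', hkdef]
      ring
    simp only [p, Fintype.sum_sum_type, Sum.elim_inl, Sum.elim_inr, Finset.sum_const,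
      Finset.card_univ, nsmul_eq_mul, hJ, Fintype.card_sum, Nat.cast_add, Fintype.card_unit, Nat.cast_one]
    have hw0 : 0 < w := by linarith
    have h1 : w * δ * (1 / (2 * w)) = δ / 2 := by field_simp
    have h2 : (w * δ + (w * δ + 1)) * (1 / (8 * w)) = δ / 4 + 1 / (8 * w) := by
      field_simp
      ring
    have h3 : 1 / (8 * w) ≤ δ / 8 := by
      rw [div_le_div_iff₀ (by positivity) (by norm_num)]
      have h4 : w * δ = k * H := by rw [hw, div_mul_cancel₀ _ hδ.ne']
      have h5 : 1 ≤ k * H := one_le_mul_of_one_le_of_one_le (by linarith) hH1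
      linarith
    linarith
  have hunion := one_sub_le_of_union (P := P) (E := E) (p := p)
    (G := {ω | ∀ ψ : GeneralPolicy S A H, visitationEntropy (visitation (ψ.law M)) -
      visitationEntropy (visitation (mixtureLaw M pol ω)) ≤ ε})
    (seqProb_nonneg (pol.kernel_nonneg M) T) (sum_seqProb (pol.sum_kernel M) T) hEp ?_
  · exact le_trans (by linarith) hunion
  intro ω hω hgood ψ
  have hg1 : ∀ (h : Fin H) (s : S) (a : A) (t : ℕ) (ht : t ≤ T),
      transRatio M h s a t (fun i => ω (i.castLE ht)) < 2 * w := by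
    intro h s a t ht
    by_contra hcon
    exact hgood (Sum.inl (h, s, a)) ⟨t, ht, not_lt.mp hcon⟩
  have hg2 : ∀ (h : Fin H) (x : S × A), |(count ω h x.1 x.2 : ℝ) - D ω h x| ≤
      lam * D ω h x + β / lam := by
    intro h x
    have h1 : ¬ lam * D ω h x + β / lam ≤ 1 * (count ω h x.1 x.2 - D ω h x) :=
      hgood (Sum.inr (Sum.inl (h, x)))
    have h2 : ¬ lam * D ω h x + β / lam ≤ (-1) * (count ω h x.1 x.2 - D ω h x) :=
      hgood (Sum.inr (Sum.inr (Sum.inl (h, x))))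
    rw [abs_le]
    constructor <;> linarith
  have hg3 : ¬ 2 * H ^ 2 * ℓ * (lam' * T + β / lam') ≤ _ :=
    hgood (Sum.inr (Sum.inr (Sum.inr ())))
  replace hg3 := (not_le.mp hg3).le
  rw [hlT, hlβ] at hg3
  have hK : 2 * w = 2 * Fintype.card S * Fintype.card A * H / δ := by rw [hw, hkdef]; ring
  have hacc : ∀ t : Fin T, AccurateTrans M δ (fun i : Fin t => ω (i.castLE t.isLt.le)) :=
    fun t => accurateTrans_of_transRatio_lt hH hδ hδ1
      (fun i h => trans_ne_zero_of_seqProb_ne_zero hω _ h)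
      (fun h s a => hK ▸ hg1 h s a t t.isLt.le)
  have hgap := entropy_gap_le hpol hT ω (ψ.isEpisodeLaw M) (R := R) (c := c) (lam := lam) (β := β)
    (μ := 4 * H ^ 2 * ℓ * Real.sqrt (β * T)) hR0 hc0 hacc
    (fun t => mul_le_mul_of_nonneg_right (hℓt t t.isLt) (Nat.cast_nonneg _))
    (fun t h s a _ => two_mul_realBonus_le hH hδ hδ1 t.isLt.le _ h s a) hg2
    (by
      have hg3' := sub_le_iff_le_add'.mp hg3
      refine hg3'.trans (le_of_eq ?_)
      congr 1
      ring)
  have htot := total_regret_le (H := (H : ℝ)) (k := k) (T := T) (ℓ := ℓ)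
    (ℓ₁ := Real.log (T + 1)) (Λ := Λ) (β := β) (ε := ε) hH1 (by linarith) hTR.le hℓ1
    (Real.log_le_log (by linarith) (by linarith)) (by linarith) (by linarith) hnum
  rw [hcardk, hmT, show k * (β / lam) = Real.sqrt (k * β * T) by rw [← mul_div_assoc, hmβ],
    ← two_mul] at hgap
  have hfin := hgap.trans htot
  rw [mul_comm ε] at hfin
  exact le_of_mul_le_mul_left hfin hTR

end Main

end MVEE

end

theorem mainTheorem1 :
    -- EntGame with prior count 1 and that many episodes is PAC
    (∀ (S A : Type*) [Fintype S] [DecidableEq S] [Fintype A] [DecidableEq A] [Nonempty A]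
        (H : ℕ) (_ : 0 < H) (M : MVEE.MDP S A H) (ε δ : ℝ) (_ : 0 < ε) (_ : 0 < δ) (_ : δ < 1)
        (pol : MVEE.SamplingRule S A H) (_ : MVEE.IsEntGame 1 δ pol) (T : ℕ) (_ : 0 < T)
        (_ : MVEE.episodeBound (Fintype.card S) (Fintype.card A) H ε δ ≤ T),
        MVEE.IsPAC M pol T (MVEE.mixtureLaw M pol) ε δ) ∧
    -- that number of episodes is of order `H⁴S²A/ε² + HSA/ε` up to logarithmic factors
    (∃ C : ℝ, ∀ (S A H : ℕ) (_ : 0 < S) (_ : 0 < A) (_ : 0 < H)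
        (ε δ : ℝ) (_ : 0 < ε) (_ : ε ≤ 1) (_ : 0 < δ) (_ : δ < 1),
        (⌈MVEE.episodeBound S A H ε δ⌉₊ : ℝ) ≤
          C * Real.log (4 * S * A * H / (δ * ε)) ^ 3 *
            ((H : ℝ) ^ 4 * S ^ 2 * A / ε ^ 2 + H * S * A / ε)) := by
  refine ⟨?_, MVEE.ceil_episodeBound_le⟩
  intro S A _ _ _ _ _ H hH M ε δ hε hδ hδ1 pol hpol T hT hB
  exact MVEE.entGame_isPAC hH hε hδ hδ1 hpol hT hB
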